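/- Let $G$ be a connected real Lie group (smooth, finite-dimensional) whose Lie algebra $\mathfrak g=T_eG$ (with the bracket of left-invariant vector fields) is simple, let $\langle\cdot,\cdot\rangle$ be the Killing form of $\mathfrak g$, put $\omega_e(X,Y,Z)=\langle X,[Y,Z]\rangle\in\Lambda^3\mathfrak g^*$, and let $\omega\in\Omega^3(G)$ be the left-invariant form that extends $\omega_e$. Let $\zeta:\mathfrak g\to\mathfrak X(G)$, $\zeta(X)(g)=\frac{d}{dt}\big|_{0}\exp(-tX)g$, be the infinitesimal action of left translation (a right-invariant vector field for each $X$). Then: (a) $\omega$ is closed, nondegenerate (i.e. $v\mapsto\iota_v\omega_g$ is injective on $T_gG$ for every $g\in G$) and invariant under all left and right translations; so $(G,\omega)$ is 2-plectic. $\zeta$ is a Lie algebra homomorphism with $\mathcal L_{\zeta(X)}\omega=0$ for all $X$. (b) $\zeta$ is weakly Hamiltonian: there is a linear map $j:\mathfrak g\to L_0=\{(v,\alpha)\in\mathfrak X(G)\times\Omega^1(G): d\alpha=-\iota_v\omega\}$ whose vector field component is $\zeta$. (c) $\zeta$ is not strongly Hamiltonian: there is no $L_\infty$-morphism $F=(f_k)$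 from $\mathfrak g$ to the Lie 2-algebra of observables $L=L_0\oplus L_{-1}$, $L_{-1}=C^\infty(G)$, such that $f_1$ lifts $\zeta$. Here the nonzero brackets of $L$ are $l_1(f)=(0,df)$ for $f\in L_{-1}$, $l_2((v,\alpha),(w,\beta))=([v,w],\iota_w\iota_v\omega)$ and $l_3((v_1,\alpha_1),(v_2,\alpha_2),(v_3,\alpha_3))=-\iota_{v_3}\iota_{v_2}\iota_{v_1}\omega$. (d) The obstruction is the class of $\omega_e$. Let $\delta$ be the Chevalley–Eilenberg differential with trivial coefficients, $(\delta f)(X_1,\dots,X_{k+1})=\sum_{i<j}(-1)^{i+j}f([X_i,X_j],X_1,\dots,\widehat{X_i},\dots,\widehat{X_j},\dots,X_{k+1})$, and let $(C^\bullet,D)$ be the complex $C^k=\bigoplus_{i+j=k}\Lambda^i\mathfrak g^*\otimes\Omega^j(G)$, $D=\delta+(-1)^2(-1)^{i+j}d$ on bidegree $(i,j)$. Put $g_1(X)=\iota_{\zeta(X)}\omega$, $g_2(X,Y)=\iota_{\zeta(Y)}\iota_{\zeta(X)}\omega$, $g_3(X,Y,Z)=-\iota_{\zeta(Z)}\iota_{\zeta(Y)}\iota_{\zeta(X)}\omega$,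 $\gamma=g_1+g_2+g_3\in C^3$, and let $h_k$ be the class of $g_k$ in $\big(\Lambda^k\mathfrak g^*/(\Lambda^k\mathfrak g^*)_{\mathrm{ex}}\big)\otimes\big(\Omega^{3-k}(G)/\Omega^{3-k}(G)_{\mathrm{ex}}\big)$. Then $h_1=0$ and $h_2=0$; $\omega_e$ is a $\delta$-cocycle with $[\omega_e]_{CE}\neq0$ in $H^3(\mathfrak g)$; $h_3=[\omega_e]_{CE}\otimes[1]$, i.e. $h_3=[\omega_e]_{CE}$ under $H^3(\mathfrak g)=H^3(\mathfrak g)\otimes H^0_{dR}(G)$, and $h_3\neq0$. Moreover $\gamma$ and $\omega_e\otimes1$ are $D$-cocycles and $[\gamma]=[\omega_e\otimes 1]\neq0$ in $H^3(C^\bullet)$. -/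

import Mathlib

open scoped Manifold ContDiff

noncomputable section

namespace Multisymplectic

open VectorField

section Linear

variable {E : Type*} [NormedAddCommGroup E] [NormedSpace ℝ E]

theorem contDiff_curryLeft (k : ℕ) :
    ContDiff ℝ ∞ (fun T : E [⋀^Fin (k + 1)]→L[ℝ] ℝ => T.curryLeft) := by
  let L : (E [⋀^Fin (k + 1)]→L[ℝ] ℝ) →ₗᵢ[ℝ] (E →L[ℝ] E [⋀^Fin k]→L[ℝ] ℝ) :=
    ContinuousAlternatingMap.curryLeftLI
  exact ContinuousLinearMap.contDiff (𝕜 := ℝ) (E := E [⋀^Fin (k + 1)]→L[ℝ] ℝ)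
    (F := E →L[ℝ] E [⋀^Fin k]→L[ℝ] ℝ) L.toContinuousLinearMap

/-- The identity `d ι_W ι_V S = - ι_[V,W] S` in a vector space if `S`, `ι_V S`, `ι_W S` are closed. -/
theorem cartan_aux {S : E → E [⋀^Fin 3]→L[ℝ] ℝ} {V W : E → E} {y : E}
    (hS : DifferentiableAt ℝ S y) (hV : DifferentiableAt ℝ V y) (hW : DifferentiableAt ℝ W y)
    (h0 : extDeriv S y = 0) (h1 : extDeriv (fun z => (S z).curryLeft (V z)) y = 0)
    (h2 : extDeriv (fun z => (S z).curryLeft (W z)) y = 0) (a b : E) :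
    extDeriv (fun z => ((S z).curryLeft (V z)).curryLeft (W z)) y ![a, b] =
      - S y ![lieBracket ℝ V W y, a, b] := by
  have hc : Differentiable ℝ (fun T : E [⋀^Fin 3]→L[ℝ] ℝ => T.curryLeft) :=
    (contDiff_curryLeft _).differentiable (by simp)
  have hc2 : Differentiable ℝ (fun T : E [⋀^Fin 2]→L[ℝ] ℝ => T.curryLeft) :=
    (contDiff_curryLeft _).differentiable (by simp)
  have hSV : DifferentiableAt ℝ (fun z => (S z).curryLeft (V z)) y :=
    (DifferentiableAt.comp (g := fun T : E [⋀^Fin 3]→L[ℝ] ℝ => T.curryLeft) y (hc _) hS).clm_apply hV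
  have hSW : DifferentiableAt ℝ (fun z => (S z).curryLeft (W z)) y :=
    (DifferentiableAt.comp (g := fun T : E [⋀^Fin 3]→L[ℝ] ℝ => T.curryLeft) y (hc _) hS).clm_apply hW
  have hSVW : DifferentiableAt ℝ (fun z => ((S z).curryLeft (V z)).curryLeft (W z)) y :=
    (DifferentiableAt.comp (g := fun T : E [⋀^Fin 2]→L[ℝ] ℝ => T.curryLeft) y (hc2 _) hSV).clm_apply hW
  have e4 : ∀ z, (fun i => (![V, W, fun _ => a, fun _ => b] : Fin 4 → E → E) i z) =
      ![V z, W z, a, b] := fun z => by funext i; fin_cases i <;> rfl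
  have e3 : ∀ (U : E → E) z, (fun i => (![U, fun _ => a, fun _ => b] : Fin 3 → E → E) i z) =
      ![U z, a, b] := fun U z => by funext i; fin_cases i <;> rfl
  have e2 : ∀ z, (fun i => (![fun _ => a, fun _ => b] : Fin 2 → E → E) i z) =
      ![a, b] := fun z => by funext i; fin_cases i <;> rfl
  have r40 : ∀ p q r s : E, (0 : Fin 4).removeNth ![p, q, r, s] = ![q, r, s] := fun p q r s => by
    funext i; fin_cases i <;> rfl
  have r41 : ∀ p q r s : E, (1 : Fin 4).removeNth ![p, q, r, s] = ![p, r, s] := fun p q r s => by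
    funext i; fin_cases i <;> rfl
  have r42 : ∀ p q r s : E, (2 : Fin 4).removeNth ![p, q, r, s] = ![p, q, s] := fun p q r s => by
    funext i; fin_cases i <;> rfl
  have r43 : ∀ p q r s : E, (3 : Fin 4).removeNth ![p, q, r, s] = ![p, q, r] := fun p q r s => by
    funext i; fin_cases i <;> rfl
  have r30 : ∀ p q r : E, (0 : Fin 3).removeNth ![p, q, r] = ![q, r] := fun p q r => by
    funext i; fin_cases i <;> rfl
  have r31 : ∀ p q r : E, (1 : Fin 3).removeNth ![p, q, r] = ![p, r] := fun p q r => by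
    funext i; fin_cases i <;> rfl
  have r32 : ∀ p q r : E, (2 : Fin 3).removeNth ![p, q, r] = ![p, q] := fun p q r => by
    funext i; fin_cases i <;> rfl
  have r20 : ∀ p q : E, (0 : Fin 2).removeNth ![p, q] = ![q] := fun p q => by
    funext i; fin_cases i <;> rfl
  have r21 : ∀ p q : E, (1 : Fin 2).removeNth ![p, q] = ![p] := fun p q => by
    funext i; fin_cases i <;> rfl
  have r10 : ∀ p : E, (0 : Fin 1).removeNth ![p] = ![] := fun p => Subsingleton.elim _ _
  have ici : ∀ {n : ℕ} (i : Fin n) (f : Fin n → ℝ),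
      ∑ j ≥ i, f j = ∑ j, if i ≤ j then f j else 0 := fun i f => by
    rw [← Finset.sum_filter]; congr 1; ext j; simp
  have lc : lieBracket ℝ (fun _ => a) (fun _ : E => b) y = 0 := by simp [lieBracket]
  have t2' : ∀ z p q r, S z ![p, q, r] = - S z ![q, p, r] := fun z p q r => by
    have h : S z (![p, q, r] ∘ Equiv.swap 0 1) = - S z ![p, q, r] :=
      (S z).toAlternatingMap.map_swap ![p, q, r] (i := 0) (j := 1) (by decide)
    rw [← neg_eq_iff_eq_neg, ← h]; congr 1; funext i; fin_cases i <;> rfl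
  have t3 : ∀ p q r, S y ![p, q, r] = - S y ![p, r, q] := fun p q r => by
    have h : S y (![p, q, r] ∘ Equiv.swap 1 2) = - S y ![p, q, r] :=
      (S y).toAlternatingMap.map_swap ![p, q, r] (i := 1) (j := 2) (by decide)
    rw [← neg_eq_iff_eq_neg, ← h]; congr 1; funext i; fin_cases i <;> rfl
  have k0 := extDeriv_apply_vectorField (V := ![V, W, fun _ => a, fun _ => b]) hS
    (by intro i; fin_cases i <;> simp [hV, hW])
  have k1 := extDeriv_apply_vectorField (V := ![W, fun _ => a, fun _ => b]) hSV
    (by intro i; fin_cases i <;> simp [hW])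
  have k2 := extDeriv_apply_vectorField (V := ![V, fun _ => a, fun _ => b]) hSW
    (by intro i; fin_cases i <;> simp [hV])
  have k3 := extDeriv_apply_vectorField (V := ![fun _ => a, fun _ => b]) hSVW
    (by intro i; fin_cases i <;> simp)
  rw [h0] at k0
  rw [h1] at k1
  rw [h2] at k2
  simp only [e4, e3, e2, ici] at k0 k1 k2 k3
  simp [Fin.sum_univ_succ, e4, e3, e2, r40, r41, r42, r43, r30, r31, r32, r20, r21, r10, lc] at k0 k1 k2 k3
  have z0 : ∀ p q, S y ![0, p, q] = 0 := fun p q => (S y).map_coord_zero (i := 0) rfl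
  have z2 : ∀ p q, S y ![p, q, 0] = 0 := fun p q => (S y).map_coord_zero (i := 2) rfl
  have z1 : ∀ p q, S y ![p, 0, q] = 0 := fun p q => (S y).map_coord_zero (i := 1) rfl
  have q1 : ∀ c d : E, fderiv ℝ (fun x => S x ![W x, V x, c]) y d =
      - fderiv ℝ (fun x => S x ![V x, W x, c]) y d := fun c d => by
    have : (fun x => S x ![W x, V x, c]) = fun x => - S x ![V x, W x, c] :=
      funext fun x => t2' _ _ _ _
    rw [this, fderiv_fun_neg]; rfl
  rw [q1, q1, z1, t2' _ (W y), t2' _ (W y)] at k2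
  rw [z1, t2' _ (V y), t2' _ (V y)] at k1
  rw [z0] at k0
  rw [z2] at k3
  linarith

end Linear

section Manifold

variable {E : Type*} [NormedAddCommGroup E] [NormedSpace ℝ E]
  {M : Type*} [TopologicalSpace M] [ChartedSpace E M] {k : ℕ}

/-- The expression of a field of alternating forms in the chart at `x₀`: the pullback under the
inverse of the chart. -/
def localRep (α : (x : M) → TangentSpace 𝓘(ℝ, E) x [⋀^Fin k]→L[ℝ] ℝ) (x₀ : M) (y : E) :
    E [⋀^Fin k]→L[ℝ] ℝ :=
  (α ((extChartAt 𝓘(ℝ, E) x₀).symm y)).compContinuousLinearMap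
    (mfderiv 𝓘(ℝ, E) 𝓘(ℝ, E) (extChartAt 𝓘(ℝ, E) x₀).symm y)

/-- A differential form is smooth if all its expressions in charts are smooth. -/
def IsSmoothForm (α : (x : M) → TangentSpace 𝓘(ℝ, E) x [⋀^Fin k]→L[ℝ] ℝ) : Prop :=
  ∀ x₀ : M, ContDiffOn ℝ ∞ (localRep α x₀) (extChartAt 𝓘(ℝ, E) x₀).target

variable (E M k) in
/-- The subspace of smooth forms among all fields of alternating forms. -/
def formSubmodule : Submodule ℝ ((x : M) → TangentSpace 𝓘(ℝ, E) x [⋀^Fin k]→L[ℝ] ℝ) where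
  carrier := {α | IsSmoothForm α}
  zero_mem' := fun x₀ => contDiffOn_const (c := 0)
  add_mem' := fun ha hb x₀ => (ha x₀).add (hb x₀)
  smul_mem' := fun c _ ha x₀ => (ha x₀).const_smul c

variable (E M k) in
/-- The vector space `Ω^k(M)` of smooth `k`-forms. -/
def Forms : Type _ := formSubmodule E M k

instance : AddCommGroup (Forms E M k) := by
  unfold Forms; exact @Submodule.addCommGroup ℝ _ _ _ _ (formSubmodule E M k)

instance : Module ℝ (Forms E M k) := Submodule.module (formSubmodule E M k)

/-- The exterior derivative at `x`, computed in the chart at `x` and pulled back to `M`. -/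
def extDer (α : (x : M) → TangentSpace 𝓘(ℝ, E) x [⋀^Fin k]→L[ℝ] ℝ) (x : M) :
    TangentSpace 𝓘(ℝ, E) x [⋀^Fin (k+1)]→L[ℝ] ℝ :=
  (extDeriv (localRep α x) (extChartAt 𝓘(ℝ, E) x x)).compContinuousLinearMap
    (mfderiv 𝓘(ℝ, E) 𝓘(ℝ, E) (extChartAt 𝓘(ℝ, E) x) x)

variable [IsManifold 𝓘(ℝ, E) ∞ M]

theorem isOpen_target (x₀ : M) : IsOpen (extChartAt 𝓘(ℝ, E) x₀).target := isOpen_extChartAt_target x₀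

theorem mdiff_symm (x₀ : M) {y : E} (hy : y ∈ (extChartAt 𝓘(ℝ, E) x₀).target) :
    MDifferentiableAt 𝓘(ℝ, E) 𝓘(ℝ, E) (extChartAt 𝓘(ℝ, E) x₀).symm y :=
  ((contMDiffOn_extChartAt_symm (n := 1) x₀).contMDiffAt
    ((isOpen_target x₀).mem_nhds hy)).mdifferentiableAt (by simp)

theorem mdiff_chart (x₀ : M) {x : M} (hx : x ∈ (extChartAt 𝓘(ℝ, E) x₀).source) :
    MDifferentiableAt 𝓘(ℝ, E) 𝓘(ℝ, E) (extChartAt 𝓘(ℝ, E) x₀) x :=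
  (contMDiffAt_extChartAt' (n := 1) (by simpa using hx)).mdifferentiableAt (by simp)

theorem fderiv_transition (x₀ x₁ : M) {y : E} (hy : y ∈ (extChartAt 𝓘(ℝ, E) x₀).target)
    (hy₁ : (extChartAt 𝓘(ℝ, E) x₀).symm y ∈ (extChartAt 𝓘(ℝ, E) x₁).source) (w : E) :
    fderiv ℝ (extChartAt 𝓘(ℝ, E) x₁ ∘ (extChartAt 𝓘(ℝ, E) x₀).symm) y w =
      mfderiv 𝓘(ℝ, E) 𝓘(ℝ, E) (extChartAt 𝓘(ℝ, E) x₁) ((extChartAt 𝓘(ℝ, E) x₀).symm y)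
        (mfderiv 𝓘(ℝ, E) 𝓘(ℝ, E) (extChartAt 𝓘(ℝ, E) x₀).symm y w) := by
  rw [← mfderiv_eq_fderiv, mfderiv_comp (I' := 𝓘(ℝ, E)) y (mdiff_chart x₁ hy₁) (mdiff_symm x₀ hy)]
  rfl

theorem contDiffAt_transition (x₀ x₁ : M) {y : E} (hy : y ∈ (extChartAt 𝓘(ℝ, E) x₀).target)
    (hy₁ : (extChartAt 𝓘(ℝ, E) x₀).symm y ∈ (extChartAt 𝓘(ℝ, E) x₁).source) :
    ContDiffAt ℝ ∞ (extChartAt 𝓘(ℝ, E) x₁ ∘ (extChartAt 𝓘(ℝ, E) x₀).symm) y := by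
  rw [← contMDiffAt_iff_contDiffAt]
  exact (contMDiffAt_extChartAt' (by simpa using hy₁)).comp y
    ((contMDiffOn_extChartAt_symm x₀).contMDiffAt ((isOpen_target x₀).mem_nhds hy))

theorem symm_deriv_transition (x₀ x₁ : M) {y : E} (hy : y ∈ (extChartAt 𝓘(ℝ, E) x₀).target)
    (hy₁ : (extChartAt 𝓘(ℝ, E) x₀).symm y ∈ (extChartAt 𝓘(ℝ, E) x₁).source) (w : E) :
    (mfderiv 𝓘(ℝ, E) 𝓘(ℝ, E) (extChartAt 𝓘(ℝ, E) x₁).symm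
      (extChartAt 𝓘(ℝ, E) x₁ ((extChartAt 𝓘(ℝ, E) x₀).symm y))
      (fderiv ℝ (extChartAt 𝓘(ℝ, E) x₁ ∘ (extChartAt 𝓘(ℝ, E) x₀).symm) y w) : E) =
    (mfderiv 𝓘(ℝ, E) 𝓘(ℝ, E) (extChartAt 𝓘(ℝ, E) x₀).symm y w : E) := by
  have hev : (extChartAt 𝓘(ℝ, E) x₀).symm =ᶠ[nhds y] (extChartAt 𝓘(ℝ, E) x₁).symm ∘
      (extChartAt 𝓘(ℝ, E) x₁ ∘ (extChartAt 𝓘(ℝ, E) x₀).symm) := by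
    have h1 := ((continuousOn_extChartAt_symm x₀).continuousAt
      ((isOpen_target x₀).mem_nhds hy)).preimage_mem_nhds
        ((isOpen_extChartAt_source (I := 𝓘(ℝ, E)) x₁).mem_nhds hy₁)
    filter_upwards [h1] with z hz
    exact ((extChartAt 𝓘(ℝ, E) x₁).left_inv hz).symm
  rw [← mfderiv_eq_fderiv, hev.mfderiv_eq, mfderiv_comp (I' := 𝓘(ℝ, E)) y
    (mdiff_symm x₁ ((extChartAt 𝓘(ℝ, E) x₁).map_source hy₁))
    ((contDiffAt_transition x₀ x₁ hy hy₁).differentiableAt (by simp)).mdifferentiableAt]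
  rfl

theorem form_congr (α : (x : M) → TangentSpace 𝓘(ℝ, E) x [⋀^Fin k]→L[ℝ] ℝ) {p q : M} (h : p = q)
    (v w : Fin k → E) (hvw : v = w) : α p v = α q w := by
  subst h; subst hvw; rfl

theorem localRep_transition (α : (x : M) → TangentSpace 𝓘(ℝ, E) x [⋀^Fin k]→L[ℝ] ℝ)
    (x₀ x₁ : M) {y : E} (hy : y ∈ (extChartAt 𝓘(ℝ, E) x₀).target)
    (hy₁ : (extChartAt 𝓘(ℝ, E) x₀).symm y ∈ (extChartAt 𝓘(ℝ, E) x₁).source) :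
    localRep α x₀ y =
      (localRep α x₁ ((extChartAt 𝓘(ℝ, E) x₁ ∘ (extChartAt 𝓘(ℝ, E) x₀).symm) y)).compContinuousLinearMap
        (fderiv ℝ (extChartAt 𝓘(ℝ, E) x₁ ∘ (extChartAt 𝓘(ℝ, E) x₀).symm) y) := by
  ext w
  refine form_congr α ((extChartAt 𝓘(ℝ, E) x₁).left_inv hy₁).symm _ _ ?_
  funext i
  exact (symm_deriv_transition x₀ x₁ hy hy₁ (w i)).symm

/-- In every chart the exterior derivative is the one of the coordinate expression. -/
theorem localRep_extDer {α : (x : M) → TangentSpace 𝓘(ℝ, E) x [⋀^Fin k]→L[ℝ] ℝ}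
    (hα : IsSmoothForm α) (x₀ : M) {y : E} (hy : y ∈ (extChartAt 𝓘(ℝ, E) x₀).target) :
    localRep (extDer α) x₀ y = extDeriv (localRep α x₀) y := by
  set p := (extChartAt 𝓘(ℝ, E) x₀).symm y with hp
  have hps : p ∈ (extChartAt 𝓘(ℝ, E) p).source := mem_extChartAt_source p
  have hev : localRep α x₀ =ᶠ[nhds y] fun z =>
      (localRep α p ((extChartAt 𝓘(ℝ, E) p ∘ (extChartAt 𝓘(ℝ, E) x₀).symm) z)).compContinuousLinearMap
        (fderiv ℝ (extChartAt 𝓘(ℝ, E) p ∘ (extChartAt 𝓘(ℝ, E) x₀).symm) z) := by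
    have h1 := ((continuousOn_extChartAt_symm x₀).continuousAt
      ((isOpen_target x₀).mem_nhds hy)).preimage_mem_nhds
        ((isOpen_extChartAt_source (I := 𝓘(ℝ, E)) p).mem_nhds hps)
    filter_upwards [h1, (isOpen_target x₀).mem_nhds hy] with z hz hz'
    exact localRep_transition α x₀ p hz' hz
  rw [hev.extDeriv_eq, extDeriv_pullback (r := ∞)]
  · ext w
    show extDeriv (localRep α p) _ _ = extDeriv (localRep α p) _ _
    congr 1
    funext i
    exact (fderiv_transition x₀ p hy hps (w i)).symm
  · exact ((hα p).contDiffAt ((isOpen_target p).mem_nhds (mem_extChartAt_target p))).differentiableAt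
      (by simp)
  · exact contDiffAt_transition x₀ p hy hps
  · rw [minSmoothness_of_isRCLikeNormedField]; exact ENat.LEInfty.out

theorem IsSmoothForm.extDer {α : (x : M) → TangentSpace 𝓘(ℝ, E) x [⋀^Fin k]→L[ℝ] ℝ}
    (hα : IsSmoothForm α) : IsSmoothForm (extDer α) := by
  intro x₀
  have h : ContDiffOn ℝ ∞ (extDeriv (localRep α x₀)) (extChartAt 𝓘(ℝ, E) x₀).target :=
    (ContinuousAlternatingMap.alternatizeUncurryFinCLM ℝ E ℝ).contDiff.comp_contDiffOn
      ((hα x₀).fderiv_of_isOpen (isOpen_target x₀) (by simp))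
  exact h.congr fun y hy => localRep_extDer hα x₀ hy

theorem extDer_add {α β : (x : M) → TangentSpace 𝓘(ℝ, E) x [⋀^Fin k]→L[ℝ] ℝ}
    (hα : IsSmoothForm α) (hβ : IsSmoothForm β) :
    Multisymplectic.extDer (α + β) = Multisymplectic.extDer α + Multisymplectic.extDer β := by
  funext x
  have h {α : (x : M) → TangentSpace 𝓘(ℝ, E) x [⋀^Fin k]→L[ℝ] ℝ} (hα : IsSmoothForm α) :=
    ((hα x).contDiffAt ((isOpen_target x).mem_nhds (mem_extChartAt_target x))).differentiableAt
      (by simp)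
  have := extDeriv_add (h hα) (h hβ)
  ext w
  exact congrArg (fun (a : E [⋀^Fin (k+1)]→L[ℝ] ℝ) => a
    (fun i => mfderiv 𝓘(ℝ, E) 𝓘(ℝ, E) (extChartAt 𝓘(ℝ, E) x) x (w i))) this

theorem extDer_smul (c : ℝ) (α : (x : M) → TangentSpace 𝓘(ℝ, E) x [⋀^Fin k]→L[ℝ] ℝ) :
    Multisymplectic.extDer (c • α) = c • Multisymplectic.extDer α := by
  funext x
  have := extDeriv_smul (x := extChartAt 𝓘(ℝ, E) x x) c (localRep α x)
  ext w
  exact congrArg (fun (a : E [⋀^Fin (k+1)]→L[ℝ] ℝ) => a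
    (fun i => mfderiv 𝓘(ℝ, E) 𝓘(ℝ, E) (extChartAt 𝓘(ℝ, E) x) x (w i))) this

variable (E M k) in
/-- The exterior derivative `d : Ω^k(M) → Ω^{k+1}(M)`. -/
def extD : Forms E M k →ₗ[ℝ] Forms E M (k + 1) where
  toFun α := ⟨extDer α.1, α.2.extDer⟩
  map_add' α β := Subtype.ext (extDer_add α.2 β.2)
  map_smul' c α := Subtype.ext (extDer_smul c α.1)

theorem inv_symm (x₀ : M) {y : E} (hy : y ∈ (extChartAt 𝓘(ℝ, E) x₀).target) :
    (mfderiv 𝓘(ℝ, E) 𝓘(ℝ, E) (extChartAt 𝓘(ℝ, E) x₀).symm y).IsInvertible := by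
  have := isInvertible_mfderivWithin_extChartAt_symm (I := 𝓘(ℝ, E)) hy
  simpa using this

/-- The expression of a vector field in the chart at `x₀`. -/
def vecRep (v : (x : M) → TangentSpace 𝓘(ℝ, E) x) (x₀ : M) : E → E :=
  mpullback 𝓘(ℝ, E) 𝓘(ℝ, E) (extChartAt 𝓘(ℝ, E) x₀).symm v

theorem symm_vecRep (v : (x : M) → TangentSpace 𝓘(ℝ, E) x) (x₀ : M) {y : E}
    (hy : y ∈ (extChartAt 𝓘(ℝ, E) x₀).target) :
    mfderiv 𝓘(ℝ, E) 𝓘(ℝ, E) (extChartAt 𝓘(ℝ, E) x₀).symm y (vecRep (E := E) v x₀ y) =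
      v ((extChartAt 𝓘(ℝ, E) x₀).symm y) := by
  obtain ⟨e, he⟩ := inv_symm x₀ hy
  show mfderiv 𝓘(ℝ, E) 𝓘(ℝ, E) (extChartAt 𝓘(ℝ, E) x₀).symm y
    ((mfderiv 𝓘(ℝ, E) 𝓘(ℝ, E) (extChartAt 𝓘(ℝ, E) x₀).symm y).inverse _) = _
  rw [← he, ContinuousLinearMap.inverse_equiv]
  exact e.apply_symm_apply _

/-- Smooth vector fields on `M`. -/
abbrev VF (E M : Type*) [NormedAddCommGroup E] [NormedSpace ℝ E] [TopologicalSpace M]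
    [ChartedSpace E M] [IsManifold 𝓘(ℝ, E) ∞ M] : Type _ :=
  ContMDiffSection 𝓘(ℝ, E) E ∞ (fun x : M => TangentSpace 𝓘(ℝ, E) x)

theorem contDiffOn_vecRep [CompleteSpace E] (v : VF E M) (x₀ : M) :
    ContDiffOn ℝ ∞ (vecRep (fun x => v x) x₀) (extChartAt 𝓘(ℝ, E) x₀).target := by
  refine contMDiffOn_vectorSpace_iff_contDiffOn.1 ?_
  intro y hy
  refine (ContMDiffAt.mpullback_vectorField_preimage (n := ∞) (v.contMDiff _) ?_ (inv_symm x₀ hy) (by simp)).contMDiffWithinAt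
  exact (contMDiffOn_extChartAt_symm x₀).contMDiffAt ((isOpen_target x₀).mem_nhds hy)

/-- The contraction `ι_v α`, i.e. `(ι_v α)(u_1, ...) = α(v, u_1, ...)`. -/
def contr0 (v : (x : M) → TangentSpace 𝓘(ℝ, E) x)
    (α : (x : M) → TangentSpace 𝓘(ℝ, E) x [⋀^Fin (k+1)]→L[ℝ] ℝ) (x : M) :
    TangentSpace 𝓘(ℝ, E) x [⋀^Fin k]→L[ℝ] ℝ :=
  ContinuousAlternatingMap.curryLeft (E := E) (α x) (v x)

theorem localRep_contr (v : (x : M) → TangentSpace 𝓘(ℝ, E) x)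
    (α : (x : M) → TangentSpace 𝓘(ℝ, E) x [⋀^Fin (k+1)]→L[ℝ] ℝ) (x₀ : M) {y : E}
    (hy : y ∈ (extChartAt 𝓘(ℝ, E) x₀).target) :
    localRep (contr0 v α) x₀ y = (localRep α x₀ y).curryLeft (vecRep v x₀ y) := by
  ext w
  refine form_congr α rfl _ _ ?_
  funext i
  refine Fin.cases ?_ (fun j => ?_) i
  · exact (symm_vecRep v x₀ hy).symm
  · rfl

theorem isSmoothForm_contr [CompleteSpace E] (v : VF E M)
    {α : (x : M) → TangentSpace 𝓘(ℝ, E) x [⋀^Fin (k+1)]→L[ℝ] ℝ} (hα : IsSmoothForm α) :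
    IsSmoothForm (contr0 (fun x => v x) α) := by
  intro x₀
  have h : ContDiffOn ℝ ∞ (fun y => (localRep α x₀ y).curryLeft (vecRep (fun x => v x) x₀ y))
      (extChartAt 𝓘(ℝ, E) x₀).target :=
    ((contDiff_curryLeft (E := E) k).comp_contDiffOn (hα x₀)).clm_apply (contDiffOn_vecRep v x₀)
  exact h.congr fun y hy => localRep_contr _ α x₀ hy

/-- The contraction `ι_v α` of a smooth form with a smooth vector field. -/
def contr [CompleteSpace E] : VF E M →ₗ[ℝ] Forms E M (k+1) →ₗ[ℝ] Forms E M k :=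
  LinearMap.mk₂ ℝ (fun v α => ⟨contr0 (fun x => v x) α.1, isSmoothForm_contr v α.2⟩)
    (fun v w α => Subtype.ext <| funext fun x =>
      (ContinuousAlternatingMap.curryLeft (E := E) (α.1 x)).map_add (v x) (w x))
    (fun c v α => Subtype.ext <| funext fun x =>
      (ContinuousAlternatingMap.curryLeft (E := E) (α.1 x)).map_smul c (v x))
    (fun _ _ _ => rfl) (fun _ _ _ => rfl)

instance : ENat.LEInfty (minSmoothness ℝ 3) := by
  rw [minSmoothness_of_isRCLikeNormedField]; infer_instance

theorem contMDiff_bracket [CompleteSpace E] (v w : VF E M) :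
    ContMDiff 𝓘(ℝ, E) (𝓘(ℝ, E).prod 𝓘(ℝ, E)) ∞ fun x => Bundle.TotalSpace.mk' E x
      (mlieBracket 𝓘(ℝ, E) (fun x => v x) (fun x => w x) x) := by
  have : IsManifold 𝓘(ℝ, E) (((⊤ : ℕ∞) : ℕ∞ω) + 1) M := by
    simpa using (inferInstance : IsManifold 𝓘(ℝ, E) ∞ M)
  exact ContDiff.mlieBracket_vectorField (m := ⊤) (n := ⊤) v.contMDiff w.contMDiff (by simp)

/-- The Lie bracket of smooth vector fields. -/
def lieBr [CompleteSpace E] : VF E M →ₗ[ℝ] VF E M →ₗ[ℝ] VF E M :=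
  have hd (v : VF E M) (x : M) : MDifferentiableAt 𝓘(ℝ, E) (𝓘(ℝ, E).prod 𝓘(ℝ, E))
      (fun x => Bundle.TotalSpace.mk' E x (v x)) x := v.mdifferentiableAt
  LinearMap.mk₂ ℝ (fun v w => ⟨_, contMDiff_bracket v w⟩)
    (fun v w u => ContMDiffSection.ext fun x => mlieBracket_add_left (hd v x) (hd w x))
    (fun c v u => ContMDiffSection.ext fun x => mlieBracket_const_smul_left (hd v x))
    (fun u v w => ContMDiffSection.ext fun x => mlieBracket_add_right (hd v x) (hd w x))
    (fun c u v => ContMDiffSection.ext fun x => mlieBracket_const_smul_right (hd v x))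

theorem lieBr_apply [CompleteSpace E] (v w : VF E M) (x : M) :
    lieBr v w x = mlieBracket 𝓘(ℝ, E) (fun x => v x) (fun x => w x) x := rfl

end Manifold

section Closure

variable {E : Type*} [NormedAddCommGroup E] [NormedSpace ℝ E] [CompleteSpace E]
  {M : Type*} [TopologicalSpace M] [ChartedSpace E M] [IsManifold 𝓘(ℝ, E) ∞ M] {k : ℕ}

theorem apply_eq_localRep (α : (x : M) → TangentSpace 𝓘(ℝ, E) x [⋀^Fin k]→L[ℝ] ℝ) (x : M)
    (u : Fin k → TangentSpace 𝓘(ℝ, E) x) :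
    α x u = localRep α x (extChartAt 𝓘(ℝ, E) x x)
      (fun i => mfderiv 𝓘(ℝ, E) 𝓘(ℝ, E) (extChartAt 𝓘(ℝ, E) x) x (u i)) := by
  refine form_congr α (extChartAt_to_inv (I := 𝓘(ℝ, E)) x).symm _ _ ?_
  funext i
  have h := mfderivWithin_extChartAt_symm_comp_mfderiv_extChartAt' (I := 𝓘(ℝ, E))
    (mem_extChartAt_source (I := 𝓘(ℝ, E)) x)
  simp only [modelWithCornersSelf_coe, Set.range_id, mfderivWithin_univ] at h
  exact (congrArg (fun L : TangentSpace 𝓘(ℝ, E) x →L[ℝ] TangentSpace 𝓘(ℝ, E) x => L (u i)) h).symm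

theorem vecRep_bracket (v w : VF E M) (x : M) :
    vecRep (fun x => lieBr v w x) x (extChartAt 𝓘(ℝ, E) x x) =
      lieBracket ℝ (vecRep (fun x => v x) x) (vecRep (fun x => w x) x)
        (extChartAt 𝓘(ℝ, E) x x) := by
  have h := mpullback_mlieBracket (I := 𝓘(ℝ, E)) (I' := 𝓘(ℝ, E)) (n := ∞)
    (f := (extChartAt 𝓘(ℝ, E) x).symm) (V := fun x => v x) (W := fun x => w x)
    (x₀ := extChartAt 𝓘(ℝ, E) x x) v.mdifferentiableAt w.mdifferentiableAt
    ((contMDiffOn_extChartAt_symm x).contMDiffAt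
      ((isOpen_target x).mem_nhds (mem_extChartAt_target x)))
    (by rw [minSmoothness_of_isRCLikeNormedField]; exact ENat.LEInfty.out)
  exact h.trans (by rw [← mlieBracketWithin_univ, mlieBracketWithin_eq_lieBracketWithin]; exact congrFun (lieBracketWithin_univ (E := E)) _)

/-- `d ι_w ι_v σ = - ι_[v,w] σ` if `σ`, `ι_v σ` and `ι_w σ` are closed. -/
theorem extD_contr_contr {σ : Forms E M 3} (hσ : extD E M 3 σ = 0) {v w : VF E M}
    (hv : extD E M 2 (contr v σ) = 0) (hw : extD E M 2 (contr w σ) = 0) :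
    extD E M 1 (contr w (contr v σ)) = - contr (lieBr v w) σ := by
  refine Subtype.ext (funext fun x => ?_)
  have hx := mem_extChartAt_target (I := 𝓘(ℝ, E)) x
  have hn := (isOpen_target (E := E) x).mem_nhds hx
  have hd {k : ℕ} {α : (x : M) → TangentSpace 𝓘(ℝ, E) x [⋀^Fin k]→L[ℝ] ℝ} (hα : IsSmoothForm α) :
      extDer α = 0 → extDeriv (localRep α x) (extChartAt 𝓘(ℝ, E) x x) = 0 := fun h => by
    rw [← localRep_extDer hα x hx, h]; rfl
  have hvr (u : VF E M) : DifferentiableAt ℝ (vecRep (fun x => u x) x) (extChartAt 𝓘(ℝ, E) x x) :=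
    ((contDiffOn_vecRep u x).contDiffAt hn).differentiableAt (by simp)
  have hloc (u : VF E M) : localRep (contr u σ).1 x =ᶠ[nhds (extChartAt 𝓘(ℝ, E) x x)]
      fun z => (localRep σ.1 x z).curryLeft (vecRep (fun x => u x) x z) := by
    filter_upwards [hn] with z hz using localRep_contr _ _ x hz
  have hloc2 : localRep (contr w (contr v σ)).1 x =ᶠ[nhds (extChartAt 𝓘(ℝ, E) x x)]
      fun z => ((localRep σ.1 x z).curryLeft (vecRep (fun x => v x) x z)).curryLeft
        (vecRep (fun x => w x) x z) := by
    filter_upwards [hn] with z hz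
    refine (localRep_contr _ _ x hz).trans ?_
    exact congrArg (fun T : E [⋀^Fin 2]→L[ℝ] ℝ => T.curryLeft (vecRep (fun x => w x) x z))
      (localRep_contr _ _ x hz)
  have key := cartan_aux (S := localRep σ.1 x) (V := vecRep (fun x => v x) x)
    (W := vecRep (fun x => w x) x) (((σ.2 x).contDiffAt hn).differentiableAt (by simp))
    (hvr v) (hvr w) (hd σ.2 (congrArg Subtype.val hσ))
    ((hloc v).extDeriv_eq ▸ hd (contr v σ).2 (congrArg Subtype.val hv))
    ((hloc w).extDeriv_eq ▸ hd (contr w σ).2 (congrArg Subtype.val hw))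
  ext u
  rw [apply_eq_localRep]
  show localRep (extDer (contr w (contr v σ)).1) x _ _ = - (contr (lieBr v w) σ).1 x u
  rw [apply_eq_localRep (contr (lieBr v w) σ).1, localRep_extDer (contr w (contr v σ)).2 x hx,
    hloc2.extDeriv_eq]
  have h2 := localRep_contr (fun x => lieBr v w x) σ.1 x hx
  rw [vecRep_bracket] at h2
  have h3 : (contr (lieBr v w) σ).1 = contr0 (fun x => lieBr v w x) σ.1 := rfl
  rw [h3, h2]
  let u' : Fin 2 → E := fun i => mfderiv 𝓘(ℝ, E) 𝓘(ℝ, E) (extChartAt 𝓘(ℝ, E) x) x (u i)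
  have h4 := key (u' 0) (u' 1)
  have e2 : ![u' 0, u' 1] = u' := by funext i; fin_cases i <;> rfl
  rw [show (![_, u' 0, u' 1] : Fin 3 → E) = Matrix.vecCons _ ![u' 0, u' 1] from rfl, e2] at h4
  exact h4

end Closure

section Multilinear

variable {V W : Type*} [AddCommGroup V] [Module ℝ V] [AddCommGroup W] [Module ℝ W]

/-- A bilinear map as a multilinear map in two variables. -/
def mul2 (B : V →ₗ[ℝ] V →ₗ[ℝ] W) : MultilinearMap ℝ (fun _ : Fin 2 => V) W where
  toFun x := B (x 0) (x 1)
  map_update_add' x i a b := by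
    rcases Subsingleton.elim ‹DecidableEq (Fin 2)› (instDecidableEqFin 2)
    fin_cases i <;> simp
  map_update_smul' x i c a := by
    rcases Subsingleton.elim ‹DecidableEq (Fin 2)› (instDecidableEqFin 2)
    fin_cases i <;> simp

/-- A trilinear map as a multilinear map in three variables. -/
def mul3 (B : V →ₗ[ℝ] V →ₗ[ℝ] V →ₗ[ℝ] W) : MultilinearMap ℝ (fun _ : Fin 3 => V) W where
  toFun x := B (x 0) (x 1) (x 2)
  map_update_add' x i a b := by
    rcases Subsingleton.elim ‹DecidableEq (Fin 3)› (instDecidableEqFin 3)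
    fin_cases i <;> simp
  map_update_smul' x i c a := by
    rcases Subsingleton.elim ‹DecidableEq (Fin 3)› (instDecidableEqFin 3)
    fin_cases i <;> simp

end Multilinear

section Cohomology

variable {A B : Type*} [AddCommGroup A] [Module ℝ A] [AddCommGroup B] [Module ℝ B]

/-- Cocycles (the kernel of `d`) modulo those which lie in the space `X` of exact elements. -/
abbrev Cohomology (d : A →ₗ[ℝ] B) (X : Submodule ℝ A) : Type _ :=
  LinearMap.ker d ⧸ X.comap (LinearMap.ker d).subtype

/-- The cohomology class of a cocycle. -/
def cohClass (d : A →ₗ[ℝ] B) (X : Submodule ℝ A) (a : A) (ha : a ∈ LinearMap.ker d) :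
    Cohomology d X :=
  Submodule.Quotient.mk ⟨a, ha⟩

end Cohomology

section ChevalleyEilenberg

variable (L : Type*) [LieRing L] [LieAlgebra ℝ L] (V : Type*) [AddCommGroup V] [Module ℝ V]

/-- The trilinear expression `(X, Y) ↦ f([X, Y], ...)`. -/
def bracketInsert (k : ℕ) :
    (L [⋀^Fin (k + 1)]→ₗ[ℝ] V) →ₗ[ℝ] (L →ₗ[ℝ] L →ₗ[ℝ] L [⋀^Fin k]→ₗ[ℝ] V) where
  toFun f := LinearMap.mk₂ ℝ (fun X Y => f.curryLeft ⁅X, Y⁆) (by simp) (by simp) (by simp) (by simp)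
  map_add' f g := by ext; simp
  map_smul' c f := by ext; simp

/-- The Chevalley-Eilenberg differential with values in the trivial module `V`; see `ceD_apply` for
the explicit formula. -/
def ceD : (k : ℕ) → (L [⋀^Fin k]→ₗ[ℝ] V) →ₗ[ℝ] (L [⋀^Fin (k + 1)]→ₗ[ℝ] V)
  | 0 => 0
  | k + 1 => (-(1 / 2 : ℝ)) • (AlternatingMap.alternatizeUncurryFinLM ∘ₗ
      LinearMap.llcomp ℝ L (L →ₗ[ℝ] L [⋀^Fin k]→ₗ[ℝ] V) (L [⋀^Fin (k + 1)]→ₗ[ℝ] V)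
        AlternatingMap.alternatizeUncurryFinLM ∘ₗ bracketInsert L V k)

/-- `(δ f)(X_1, ..., X_{k+2}) = ∑_{p < q} (-1)^{p+q} f([X_p, X_q], ..., X̂_p, ..., X̂_q, ...)`. Here
the positions are `p = i + 1` and `q = j + 2` with `i ≤ j`. -/
theorem ceD_apply (k : ℕ) (f : L [⋀^Fin (k + 1)]→ₗ[ℝ] V) (X : Fin (k + 2) → L) :
    ceD L V (k + 1) f X = ∑ i : Fin (k + 1), ∑ j ≥ i,
      (-1 : ℝ) ^ ((i + 1) + (j + 2) : ℕ) •
        f (Matrix.vecCons ⁅X i.castSucc, X j.succ⁆ (j.removeNth (i.castSucc.removeNth X))) := by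
  have h := AlternatingMap.alternatizeUncurryFin_alternatizeUncurryFinLM_comp_apply
    (bracketInsert L V k f) X
  have h2 : ceD L V (k + 1) f X = (-(1 / 2 : ℝ)) • AlternatingMap.alternatizeUncurryFin
    (AlternatingMap.alternatizeUncurryFinLM ∘ₗ bracketInsert L V k f) X := rfl
  rw [h2, h, Finset.smul_sum]
  refine Finset.sum_congr rfl fun i _ => ?_
  rw [Finset.smul_sum]
  refine Finset.sum_congr rfl fun j _ => ?_
  have h3 : bracketInsert L V k f (X j.succ) (X i.castSucc) =
      - bracketInsert L V k f (X i.castSucc) (X j.succ) := by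
    show f.curryLeft _ = - f.curryLeft _
    rw [← lie_skew, map_neg]
  rw [h3, AlternatingMap.neg_apply, sub_neg_eq_add, ← two_smul ℝ, ← Int.cast_smul_eq_zsmul ℝ,
    smul_smul, smul_smul]
  congr 1
  push_cast
  ring

/-- Exact cochains. -/
def ceExact : (k : ℕ) → Submodule ℝ (L [⋀^Fin k]→ₗ[ℝ] V)
  | 0 => ⊥
  | k + 1 => LinearMap.range (ceD L V k)

/-- The Lie algebra cohomology `H^k(L)` with coefficients in the trivial module `V`. -/
abbrev ceH (k : ℕ) : Type _ := Cohomology (ceD L V k) (ceExact L V k)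

variable {V} {W : Type*} [AddCommGroup W] [Module ℝ W]

theorem ceD_comp (k : ℕ) (T : V →ₗ[ℝ] W) (f : L [⋀^Fin k]→ₗ[ℝ] V) :
    ceD L W k (T.compAlternatingMap f) = T.compAlternatingMap (ceD L V k f) := by
  cases k with
  | zero => simp [ceD]
  | succ k => ext X; simp [ceD_apply]

end ChevalleyEilenberg

section LInfinity

/-- A graded vector space with multibrackets `br k` in `k` arguments. -/
structure BracketData (V : Type*) [AddCommGroup V] [Module ℝ V] where
  gr : ℤ → Submodule ℝ V
  br : (k : ℕ) → MultilinearMap ℝ (fun _ : Fin k => V) V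

/-- The Koszul sign of a permutation acting on homogeneous elements of degrees `d`. -/
def koszulSign {n : ℕ} (s : Equiv.Perm (Fin n)) (d : Fin n → ℤ) : ℤˣ :=
  ∏ i, ∏ j, if i < j ∧ s j < s i then (d (s i) * d (s j)).negOnePow else 1

/-- `(p, n - p)`-unshuffles. -/
def IsUnshuffle {n : ℕ} (p : ℕ) (s : Equiv.Perm (Fin n)) : Prop :=
  ∀ a b : Fin n, a < b → (b.val < p ∨ p ≤ a.val) → s a < s b

/-- Unshuffles of type `(k_1, ..., k_p)`, where the composition `c` of `n` has blocks `k_j`, such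
that the first entries of blocks of the same size are increasing. -/
def IsBlockUnshuffle {n : ℕ} (c : Composition n) (s : Equiv.Perm (Fin n)) : Prop :=
  (∀ j : Fin c.length, StrictMono fun a => s (c.embedding j a)) ∧
  ∀ i j : Fin c.length, i < j → c.blocksFun i = c.blocksFun j →
    s (c.embedding i ⟨0, c.blocks_pos' i i.2⟩) < s (c.embedding j ⟨0, c.blocks_pos' j j.2⟩)

/-- The exponent `β` of the sign on the right-hand side of the equation of an `L_∞`-morphism. -/
def signExponent {n : ℕ} (c : Composition n) (s : Equiv.Perm (Fin n)) (d : Fin n → ℤ) : ℤ :=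
  ((c.length * (c.length - 1) / 2 : ℕ) : ℤ) +
    ∑ j : Fin c.length, (c.blocksFun j : ℤ) * ((c.length : ℤ) - (j.val + 1)) +
    ∑ j : Fin c.length, ((c.blocksFun j : ℤ) - 1) *
      ∑ a : Fin n, if a.val < c.sizeUpTo j then d (s a) else 0

open Classical in
/-- `L_∞`-morphisms. The component `f 0` plays no role. -/
structure LInftyMorphism {V W : Type*} [AddCommGroup V] [Module ℝ V] [AddCommGroup W] [Module ℝ W]
    (A : BracketData V) (B : BracketData W) where
  f : (k : ℕ) → MultilinearMap ℝ (fun _ : Fin k => V) W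
  degree : ∀ k, 1 ≤ k → ∀ (d : Fin k → ℤ) (x : Fin k → V), (∀ i, x i ∈ A.gr (d i)) →
    f k x ∈ B.gr (∑ i, d i + 1 - k)
  skew : ∀ k, 1 ≤ k → ∀ (d : Fin k → ℤ) (x : Fin k → V), (∀ i, x i ∈ A.gr (d i)) →
    ∀ s : Equiv.Perm (Fin k),
      f k (x ∘ s) = (Equiv.Perm.sign s * koszulSign s d) • f k x
  relation : ∀ n, 1 ≤ n → ∀ (d : Fin n → ℤ) (x : Fin n → V), (∀ i, x i ∈ A.gr (d i)) →
    (∑ i : Fin n, ∑ s ∈ Finset.univ.filter (fun s : Equiv.Perm (Fin n) => IsUnshuffle (i + 1) s),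
      ((-1) ^ ((i.val + 1) * ((n - i.val) + 1)) * Equiv.Perm.sign s * koszulSign s d) •
        f (n - (i + 1) + 1) (Fin.cons (A.br (i + 1) fun a => x (s ⟨a, by omega⟩))
          fun b => x (s ⟨i + 1 + b, by omega⟩))) =
    ∑ c ∈ Finset.univ.filter (fun c : Composition n => Monotone c.blocksFun),
      ∑ s ∈ Finset.univ.filter (fun s : Equiv.Perm (Fin n) => IsBlockUnshuffle c s),
        ((signExponent c s d).negOnePow * Equiv.Perm.sign s * koszulSign s d) •
          B.br c.length fun j => f (c.blocksFun j) fun a => x (s (c.embedding j a))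

/-- A Lie algebra as an `L_∞`-algebra concentrated in degree zero. -/
def lieBracketData (L : Type*) [LieRing L] [LieAlgebra ℝ L] : BracketData L where
  gr i := if i = 0 then ⊤ else ⊥
  br
    | 2 => mul2 (LinearMap.mk₂ ℝ (fun X Y => ⁅X, Y⁆) (by simp) (by simp) (by simp) (by simp))
    | _ => 0

end LInfinity

section Observables

variable {E : Type*} [NormedAddCommGroup E] [NormedSpace ℝ E] [CompleteSpace E]
  {M : Type*} [TopologicalSpace M] [ChartedSpace E M] [IsManifold 𝓘(ℝ, E) ∞ M] {k : ℕ}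

/-- The Lie derivative of a form along a vector field (Cartan's formula). -/
def lieDer (v : VF E M) (α : Forms E M (k + 1)) : Forms E M (k + 1) :=
  extD E M k (contr v α) + contr v (extD E M (k + 1) α)

/-- Nondegeneracy: `v ↦ ι_v σ` is injective at each point. -/
def Nondegenerate (σ : Forms E M (k + 1)) : Prop :=
  ∀ (x : M) (v : TangentSpace 𝓘(ℝ, E) x),
    (∀ u : Fin k → TangentSpace 𝓘(ℝ, E) x, σ.1 x (Matrix.vecCons v u) = 0) → v = 0

/-- `f^* σ = σ`. -/
def PullbackInvariant (f : M → M) (σ : Forms E M k) : Prop :=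
  ∀ (x : M) (u : Fin k → TangentSpace 𝓘(ℝ, E) x),
    σ.1 (f x) (fun i => mfderiv 𝓘(ℝ, E) 𝓘(ℝ, E) f x (u i)) = σ.1 x u

theorem extD_extD (α : Forms E M k) : extD E M (k + 1) (extD E M k α) = 0 := by
  refine Subtype.ext (funext fun x => ?_)
  have hx := mem_extChartAt_target (I := 𝓘(ℝ, E)) x
  have hn := (isOpen_target (E := E) x).mem_nhds hx
  have h1 : localRep (extDer α.1) x =ᶠ[nhds (extChartAt 𝓘(ℝ, E) x x)]
      extDeriv (localRep α.1 x) := by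
    filter_upwards [hn] with z hz using localRep_extDer α.2 x hz
  have h2 : extDeriv (localRep (extDer α.1) x) (extChartAt 𝓘(ℝ, E) x x) = 0 := by
    rw [h1.extDeriv_eq]
    exact extDeriv_extDeriv_apply (r := ∞) ((α.2 x).contDiffAt hn)
      (by rw [minSmoothness_of_isRCLikeNormedField]; exact ENat.LEInfty.out)
  ext u
  exact congrArg (fun T : E [⋀^Fin (k + 2)]→L[ℝ] ℝ => T fun i =>
    mfderiv 𝓘(ℝ, E) 𝓘(ℝ, E) (extChartAt 𝓘(ℝ, E) x) x (u i)) h2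

theorem contr_self (v : VF E M) (α : Forms E M (k + 2)) : contr v (contr v α) = 0 := by
  refine Subtype.ext (funext fun x => ?_)
  ext u
  exact (α.1 x).map_eq_zero_of_eq (Matrix.vecCons (v x) (Matrix.vecCons (v x) u))
    (i := 0) (j := 1) rfl (by simp)

theorem contr_swap (v w : VF E M) (α : Forms E M (k + 2)) :
    contr v (contr w α) = - contr w (contr v α) := by
  have h := contr_self (v + w) α
  simp only [map_add, LinearMap.add_apply, contr_self, zero_add, add_zero] at h
  exact eq_neg_of_add_eq_zero_right h

/-- The degree zero part of the observables of a manifold with a closed `3`-form `σ`: pairs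
`(v, α)` with `d α = - ι_v σ`. -/
def HamPairs (σ : Forms E M 3) : Submodule ℝ (VF E M × Forms E M 1) where
  carrier := {p | extD E M 1 p.2 = - contr p.1 σ}
  zero_mem' := by simp
  add_mem' := fun {a b} ha hb => by
    simp only [Set.mem_ofPred_eq] at ha hb
    simp [ha, hb, add_comm]
  smul_mem' := fun c a ha => by
    simp only [Set.mem_ofPred_eq] at ha
    simp [ha]

theorem extD_contr_of_mem {σ : Forms E M 3} (p : HamPairs σ) : extD E M 2 (contr p.1.1 σ) = 0 := by
  have h : extD E M 1 p.1.2 = - contr p.1.1 σ := p.2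
  rw [← neg_neg (contr p.1.1 σ), ← h, map_neg, extD_extD, neg_zero]

/-- The total space `L_0 ⊕ L_{-1}` of observables. -/
abbrev Observables (σ : Forms E M 3) : Type _ := HamPairs σ × Forms E M 0

/-- `l_1 f = (0, d f)` for a function `f` and `l_1 = 0` on `L_0`. -/
def obsBr1 (σ : Forms E M 3) : Observables σ →ₗ[ℝ] Observables σ where
  toFun x := (⟨(0, extD E M 0 x.2), by
    show extD E M 1 (extD E M 0 x.2) = - contr 0 σ
    simp [extD_extD]⟩, 0)
  map_add' x y := by ext1 <;> simp
  map_smul' c x := by ext1 <;> simp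

/-- `l_2((v, α), (w, β)) = ([v, w], ι_w ι_v σ)`. -/
def obsBr2 {σ : Forms E M 3} (hσ : extD E M 3 σ = 0) :
    Observables σ →ₗ[ℝ] Observables σ →ₗ[ℝ] Observables σ :=
  LinearMap.mk₂ ℝ
    (fun x y => (⟨(lieBr x.1.1.1 y.1.1.1, contr y.1.1.1 (contr x.1.1.1 σ)),
      extD_contr_contr hσ (extD_contr_of_mem x.1) (extD_contr_of_mem y.1)⟩, 0))
    (fun _ _ _ => Prod.ext (Subtype.ext (by simp)) (by simp))
    (fun _ _ _ => Prod.ext (Subtype.ext (by simp)) (by simp))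
    (fun _ _ _ => Prod.ext (Subtype.ext (by simp)) (by simp))
    (fun _ _ _ => Prod.ext (Subtype.ext (by simp)) (by simp))

/-- `l_3((v_1, α_1), (v_2, α_2), (v_3, α_3)) = - ι_{v_3} ι_{v_2} ι_{v_1} σ`. -/
def obsBr3 (σ : Forms E M 3) :
    Observables σ →ₗ[ℝ] Observables σ →ₗ[ℝ] Observables σ →ₗ[ℝ] Observables σ :=
  LinearMap.mk₂ ℝ
    (fun x y =>
      { toFun := fun z => (0, - contr z.1.1.1 (contr y.1.1.1 (contr x.1.1.1 σ)))
        map_add' := fun _ _ => Prod.ext (by simp) (by simp; exact add_comm _ _)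
        map_smul' := fun _ _ => by ext1 <;> simp })
    (fun _ _ _ => LinearMap.ext fun z => Prod.ext (by simp) (by simp; exact add_comm _ _))
    (fun _ _ _ => LinearMap.ext fun z => Prod.ext (by simp) (by simp))
    (fun _ _ _ => LinearMap.ext fun z => Prod.ext (by simp) (by simp; exact add_comm _ _))
    (fun _ _ _ => LinearMap.ext fun z => Prod.ext (by simp) (by simp))

/-- The Lie `2`-algebra of observables of `(M, σ)`. -/
def observables {σ : Forms E M 3} (hσ : extD E M 3 σ = 0) : BracketData (Observables σ) where
  gr i := if i = 0 then Submodule.prod ⊤ ⊥ else if i = -1 then Submodule.prod ⊥ ⊤ else ⊥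
  br
    | 1 => MultilinearMap.ofSubsingleton ℝ _ _ (0 : Fin 1) (obsBr1 σ)
    | 2 => mul2 (obsBr2 hσ)
    | 3 => mul3 (obsBr3 σ)
    | _ => 0

variable {L : Type*} [LieRing L] [LieAlgebra ℝ L]

/-- The infinitesimal action `ζ` admits a linear lift to Hamiltonian pairs. -/
def WeaklyHamiltonian (σ : Forms E M 3) (ζ : L →ₗ[ℝ] VF E M) : Prop :=
  ∃ j : L →ₗ[ℝ] HamPairs σ, ∀ X, (j X).1.1 = ζ X

/-- The infinitesimal action `ζ` admits a homotopy co-moment map: an `L_∞`-morphism to the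
observables which lifts `ζ`. -/
def StronglyHamiltonian {σ : Forms E M 3} (hσ : extD E M 3 σ = 0) (ζ : L →ₗ[ℝ] VF E M) : Prop :=
  ∃ F : LInftyMorphism (lieBracketData L) (observables hσ), ∀ X, (F.f 1 ![X]).1.1.1 = ζ X

/-- `g_1(X) = ι_{ζ(X)} σ`. -/
def cocycle1 (σ : Forms E M 3) (ζ : L →ₗ[ℝ] VF E M) : L [⋀^Fin 1]→ₗ[ℝ] Forms E M 2 :=
  AlternatingMap.ofSubsingleton ℝ L (Forms E M 2) (0 : Fin 1) (contr.flip σ ∘ₗ ζ)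

/-- `g_2(X, Y) = ι_{ζ(Y)} ι_{ζ(X)} σ`. -/
def cocycle2 (σ : Forms E M 3) (ζ : L →ₗ[ℝ] VF E M) : L [⋀^Fin 2]→ₗ[ℝ] Forms E M 1 where
  toMultilinearMap := mul2 (LinearMap.mk₂ ℝ (fun X Y => contr (ζ Y) (contr (ζ X) σ))
    (by simp) (by simp) (by simp) (by simp))
  map_eq_zero_of_eq' X i j h hij := by
    show contr (ζ (X 1)) (contr (ζ (X 0)) σ) = 0
    have h01 : X 0 = X 1 := by
      fin_cases i <;> fin_cases j <;> simp_all
    rw [h01, contr_self]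

/-- `g_3(X, Y, Z) = - ι_{ζ(Z)} ι_{ζ(Y)} ι_{ζ(X)} σ`. -/
def cocycle3 (σ : Forms E M 3) (ζ : L →ₗ[ℝ] VF E M) : L [⋀^Fin 3]→ₗ[ℝ] Forms E M 0 where
  toMultilinearMap := mul3 (LinearMap.mk₂ ℝ
    (fun X Y => -(contr.flip (contr (ζ Y) (contr (ζ X) σ)) ∘ₗ ζ))
    (fun _ _ _ => by ext1; simp; exact add_comm _ _) (fun _ _ _ => by ext1; simp)
    (fun _ _ _ => by ext1; simp; exact add_comm _ _) (fun _ _ _ => by ext1; simp))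
  map_eq_zero_of_eq' X i j h hij := by
    show -(contr (ζ (X 2)) (contr (ζ (X 1)) (contr (ζ (X 0)) σ))) = 0
    have h01 : X 0 = X 1 ∨ X 1 = X 2 ∨ X 0 = X 2 := by
      fin_cases i <;> fin_cases j <;> simp_all
    rcases h01 with h | h | h
    · rw [h, contr_self, map_zero, neg_zero]
    · rw [h, contr_self, neg_zero]
    · rw [h, contr_swap, contr_self]; simp

end Observables

section DoubleComplex

variable (E : Type*) [NormedAddCommGroup E] [NormedSpace ℝ E] [CompleteSpace E]
  (M : Type*) [TopologicalSpace M] [ChartedSpace E M] [IsManifold 𝓘(ℝ, E) ∞ M]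
  (L : Type*) [LieRing L] [LieAlgebra ℝ L]

/-- Families of elements of `Λ^i L^* ⊗ Ω^j(M) = Λ^i(L, Ω^j(M))`. -/
abbrev BiCochain : Type _ := (i j : ℕ) → (L [⋀^Fin i]→ₗ[ℝ] Forms E M j)

/-- The part `C^k = ⨁_{i + j = k} Λ^i L^* ⊗ Ω^j(M)` of total degree `k`. -/
def totalDegree (k : ℕ) : Submodule ℝ (BiCochain E M L) where
  carrier := {p | ∀ i j, i + j ≠ k → p i j = 0}
  zero_mem' := fun _ _ _ => rfl
  add_mem' := fun ha hb i j h => by simp [ha i j h, hb i j h]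
  smul_mem' := fun c a ha i j h => by simp [ha i j h]

/-- The contribution of `δ` to the total differential. -/
def totalDelta : BiCochain E M L →ₗ[ℝ] BiCochain E M L where
  toFun p
    | 0, _ => 0
    | i + 1, j => ceD L (Forms E M j) i (p i j)
  map_add' p q := by funext i j; cases i <;> simp
  map_smul' c p := by funext i j; cases i <;> simp

/-- The contribution of `d` to the total differential: `(-1)^n (-1)^{i + j} d` on bidegree
`(i, j)`, where `n = 2`. -/
def totalDe : BiCochain E M L →ₗ[ℝ] BiCochain E M L where
  toFun p
    | _, 0 => 0
    | i, j + 1 => ((-1 : ℝ) ^ 2 * (-1) ^ (i + j)) • (extD E M j).compAlternatingMap (p i j)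
  map_add' p q := by funext i j; cases j <;> simp
  map_smul' c p := by funext i j; cases j <;> simp [smul_comm _ c]

/-- The total differential `D = δ + (-1)^n (-1)^{i + j} d`, where `n = 2`. -/
def totalD : BiCochain E M L →ₗ[ℝ] BiCochain E M L := totalDelta E M L + totalDe E M L

/-- Total coboundaries of degree `k`. -/
def totalExact : (k : ℕ) → Submodule ℝ (BiCochain E M L)
  | 0 => ⊥
  | k + 1 => (totalDegree E M L k).map (totalD E M L)

end DoubleComplex

section Mixed

variable (E : Type*) [NormedAddCommGroup E] [NormedSpace ℝ E] [CompleteSpace E]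
  (M : Type*) [TopologicalSpace M] [ChartedSpace E M] [IsManifold 𝓘(ℝ, E) ∞ M]
  (L : Type*) [LieRing L] [LieAlgebra ℝ L]

/-- Exact differential forms. -/
def exactForms : (j : ℕ) → Submodule ℝ (Forms E M j)
  | 0 => ⊥
  | j + 1 => LinearMap.range (extD E M j)

/-- `Λ^k L^* ⊗ Ω^j_ex`: alternating maps with values in exact forms. -/
def exactValued (k j : ℕ) : Submodule ℝ (L [⋀^Fin k]→ₗ[ℝ] Forms E M j) where
  carrier := {f | ∀ X, f X ∈ exactForms E M j}
  zero_mem' := fun _ => zero_mem _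
  add_mem' := fun ha hb X => add_mem (ha X) (hb X)
  smul_mem' := fun c _ ha X => Submodule.smul_mem _ c (ha X)

/-- `(Λ^k L^* / exact) ⊗ (Ω^j / exact)`, i.e. the quotient of `Λ^k L^* ⊗ Ω^j(M)` by
`(Λ^k L^*)_ex ⊗ Ω^j + Λ^k L^* ⊗ Ω^j_ex`. -/
abbrev MixedQuotient (k j : ℕ) : Type _ :=
  (L [⋀^Fin k]→ₗ[ℝ] Forms E M j) ⧸ (ceExact L (Forms E M j) k ⊔ exactValued E M L k j)

/-- Real numbers as constant functions. -/
def constForm : ℝ →ₗ[ℝ] Forms E M 0 where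
  toFun c := ⟨fun x => ContinuousAlternatingMap.constOfIsEmpty ℝ (TangentSpace 𝓘(ℝ, E) x) (Fin 0) c,
    fun _ => contDiffOn_const (c := ContinuousAlternatingMap.constOfIsEmpty ℝ E (Fin 0) c)⟩
  map_add' _ _ := rfl
  map_smul' _ _ := rfl

/-- The map `a ↦ a ⊗ 1` from `Λ^k L^*` to `Λ^k L^* ⊗ Ω^0(M)`. -/
def tensorOne (k : ℕ) : (L [⋀^Fin k]→ₗ[ℝ] ℝ) →ₗ[ℝ] (L [⋀^Fin k]→ₗ[ℝ] Forms E M 0) where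
  toFun a := (constForm E M).compAlternatingMap a
  map_add' a b := by ext1 X; simp
  map_smul' c a := by ext1 X; simp

theorem tensorOne_exact (k : ℕ) {a : L [⋀^Fin k]→ₗ[ℝ] ℝ} (ha : a ∈ ceExact L ℝ k) :
    tensorOne E M L k a ∈ ceExact L (Forms E M 0) k := by
  cases k with
  | zero => rw [(Submodule.mem_bot ℝ).1 ha, map_zero]; exact zero_mem _
  | succ k =>
    obtain ⟨b, rfl⟩ := ha
    exact ⟨tensorOne E M L k b, ceD_comp L k (constForm E M) b⟩

/-- The map `H^k(L) → (Λ^k L^* / exact) ⊗ (Ω^0 / exact)`, `[a] ↦ [a] ⊗ [1]`, which realizes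
`H^k(L) = H^k(L) ⊗ H^0(M)` for connected `M`. -/
def ceHToMixed (k : ℕ) : ceH L ℝ k →ₗ[ℝ] MixedQuotient E M L k 0 :=
  Submodule.liftQ _ (Submodule.mkQ _ ∘ₗ tensorOne E M L k ∘ₗ (LinearMap.ker (ceD L ℝ k)).subtype)
    fun a ha => (Submodule.Quotient.mk_eq_zero _).2
      (Submodule.mem_sup_left (tensorOne_exact E M L k ha))

/-- The total cochain `a ⊗ 1` of bidegree `(3, 0)`. -/
def totalTensorOne (a : L [⋀^Fin 3]→ₗ[ℝ] ℝ) : BiCochain E M L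
  | 3, 0 => tensorOne E M L 3 a
  | _, _ => 0

variable {E M L}

/-- The class `h_1` of `g_1`. -/
def obstruction1 (σ : Forms E M 3) (ζ : L →ₗ[ℝ] VF E M) : MixedQuotient E M L 1 2 :=
  Submodule.Quotient.mk (cocycle1 σ ζ)

/-- The class `h_2` of `g_2`. -/
def obstruction2 (σ : Forms E M 3) (ζ : L →ₗ[ℝ] VF E M) : MixedQuotient E M L 2 1 :=
  Submodule.Quotient.mk (cocycle2 σ ζ)

/-- The class `h_3` of `g_3`. -/
def obstruction3 (σ : Forms E M 3) (ζ : L →ₗ[ℝ] VF E M) : MixedQuotient E M L 3 0 :=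
  Submodule.Quotient.mk (cocycle3 σ ζ)

/-- The cochain `g = g_1 + g_2 + g_3` of total degree `3`. -/
def totalCocycle (σ : Forms E M 3) (ζ : L →ₗ[ℝ] VF E M) : BiCochain E M L
  | 1, 2 => cocycle1 σ ζ
  | 2, 1 => cocycle2 σ ζ
  | 3, 0 => cocycle3 σ ζ
  | _, _ => 0

variable (E M L) in
/-- Total cocycles of degree `k`. -/
def totalCocycles (k : ℕ) : Submodule ℝ (BiCochain E M L) :=
  totalDegree E M L k ⊓ LinearMap.ker (totalD E M L)

variable (E M L) in
/-- The total cohomology `H^k(C)` of the double complex. -/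
abbrev TotalH (k : ℕ) : Type _ :=
  totalCocycles E M L k ⧸ (totalExact E M L k).comap (totalCocycles E M L k).subtype

/-- The class of a total cocycle. -/
def totalClass (k : ℕ) (p : BiCochain E M L) (hp : p ∈ totalCocycles E M L k) : TotalH E M L k :=
  Submodule.Quotient.mk ⟨p, hp⟩

end Mixed

section Cartan

variable (L : Type*) [LieRing L] [LieAlgebra ℝ L]

/-- The Cartan `3`-form `(X, Y, Z) ↦ ⟨X, [Y, Z]⟩` of the Killing form. -/
def cartan3 : L [⋀^Fin 3]→ₗ[ℝ] ℝ where
  toMultilinearMap := mul3 (LinearMap.mk₂ ℝ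
    (fun X Y => killingForm ℝ L X ∘ₗ (LieAlgebra.ad ℝ L Y : L →ₗ[ℝ] L))
    (fun _ _ _ => by ext1; simp) (fun _ _ _ => by ext1; simp)
    (fun _ _ _ => by ext1; simp) (fun _ _ _ => by ext1; simp))
  map_eq_zero_of_eq' X i j h hij := by
    show killingForm ℝ L (X 0) ⁅X 1, X 2⁆ = 0
    have h01 : X 0 = X 1 ∨ X 1 = X 2 ∨ X 0 = X 2 := by
      fin_cases i <;> fin_cases j <;> simp_all
    rcases h01 with h | h | h
    · rw [h, ← LieModule.traceForm_apply_lie_apply, lie_self]; simp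
    · rw [h, lie_self, map_zero]
    · rw [h, ← lie_skew, map_neg, ← LieModule.traceForm_apply_lie_apply, lie_self]; simp

theorem cartan3_apply (X Y Z : L) : cartan3 L ![X, Y, Z] = killingForm ℝ L X ⁅Y, Z⁆ := rfl

end Cartan

section Smoothness

variable {E : Type*} [NormedAddCommGroup E] [NormedSpace ℝ E] [FiniteDimensional ℝ E]

theorem continuous_alternating {k : ℕ} (f : E [⋀^Fin k]→ₗ[ℝ] ℝ) : Continuous f := by
  let b := Module.finBasis ℝ E
  have h : (f : (Fin k → E) → ℝ) = fun x => ∑ r : Fin k → Fin (Module.finrank ℝ E),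
      (∏ i, b.repr (x i) (r i)) • f (fun i => b (r i)) := by
    funext x
    conv_lhs => rw [show x = fun i => ∑ j, b.repr (x i) j • b j from
      funext fun i => (b.sum_repr (x i)).symm]
    exact (f.toMultilinearMap.map_sum _).trans
      (Finset.sum_congr rfl fun r _ => f.toMultilinearMap.map_smul_univ _ _)
  rw [h]
  simp only [smul_eq_mul]
  refine continuous_finsetSum _ fun r _ => Continuous.mul (continuous_finsetProd _ fun i _ => ?_)
    continuous_const
  exact (LinearMap.continuous_of_finiteDimensional (b.coord (r i))).comp (continuous_apply i)

/-- On a finite-dimensional space alternating maps are continuous. -/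
def toContinuousAlternating {k : ℕ} (f : E [⋀^Fin k]→ₗ[ℝ] ℝ) : E [⋀^Fin k]→L[ℝ] ℝ :=
  { f with cont := continuous_alternating f }

theorem contDiff_pullback (k : ℕ) :
    ContDiff ℝ ∞ fun p : (E [⋀^Fin k]→L[ℝ] ℝ) × (E →L[ℝ] E) =>
      p.1.compContinuousLinearMap p.2 := by
  induction k with
  | zero =>
    have : (fun p : (E [⋀^Fin 0]→L[ℝ] ℝ) × (E →L[ℝ] E) => p.1.compContinuousLinearMap p.2) =
        fun p => p.1 := by
      funext p; ext u; exact congrArg p.1 (Subsingleton.elim _ _)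
    rw [this]; exact contDiff_fst
  | succ k ih =>
    have h1 : ContDiff ℝ ∞ fun p : (E [⋀^Fin (k + 1)]→L[ℝ] ℝ) × (E →L[ℝ] E) =>
        (ContinuousAlternatingMap.compContinuousLinearMapCLM p.2 :
          (E [⋀^Fin k]→L[ℝ] ℝ) →L[ℝ] (E [⋀^Fin k]→L[ℝ] ℝ)) ∘L (p.1.curryLeft ∘L p.2) := by
      rw [contDiff_clm_apply_iff]
      intro v
      have h2 : ContDiff ℝ ∞ fun p : (E [⋀^Fin (k + 1)]→L[ℝ] ℝ) × (E →L[ℝ] E) =>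
          ((p.1.curryLeft (p.2 v), p.2) : (E [⋀^Fin k]→L[ℝ] ℝ) × (E →L[ℝ] E)) :=
        (((contDiff_curryLeft k).comp contDiff_fst).clm_apply
          (contDiff_snd.clm_apply contDiff_const)).prodMk contDiff_snd
      exact ih.comp h2
    have h3 : (fun p : (E [⋀^Fin (k + 1)]→L[ℝ] ℝ) × (E →L[ℝ] E) =>
        p.1.compContinuousLinearMap p.2) = fun p => ((k + 1 : ℝ)⁻¹) •
          ContinuousAlternatingMap.alternatizeUncurryFinCLM ℝ E ℝ
          ((ContinuousAlternatingMap.compContinuousLinearMapCLM p.2 :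
          (E [⋀^Fin k]→L[ℝ] ℝ) →L[ℝ] (E [⋀^Fin k]→L[ℝ] ℝ)) ∘L (p.1.curryLeft ∘L p.2)) := by
      funext p
      have h4 : (ContinuousAlternatingMap.compContinuousLinearMapCLM p.2 :
          (E [⋀^Fin k]→L[ℝ] ℝ) →L[ℝ] (E [⋀^Fin k]→L[ℝ] ℝ)) ∘L (p.1.curryLeft ∘L p.2) =
          (p.1.compContinuousLinearMap p.2).curryLeft := by
        ext v u
        show p.1 _ = p.1 _
        congr 1
        funext i
        refine Fin.cases rfl (fun _ => rfl) i
      rw [h4]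
      have h5 := ContinuousAlternatingMap.alternatizeUncurryFin_curryLeft
        (p.1.compContinuousLinearMap p.2)
      show _ = _ • ContinuousAlternatingMap.alternatizeUncurryFin _
      rw [h5, ← Nat.cast_smul_eq_nsmul ℝ, smul_smul]
      push_cast
      rw [inv_mul_cancel₀ (by positivity), one_smul]
    rw [h3]
    have h6 := ContinuousLinearMap.contDiff (n := (∞ : ℕ∞ω)) (𝕜 := ℝ)
      (E := E →L[ℝ] E [⋀^Fin k]→L[ℝ] ℝ) (F := E [⋀^Fin (k + 1)]→L[ℝ] ℝ)
      (ContinuousAlternatingMap.alternatizeUncurryFinCLM (n := k) ℝ E ℝ)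
    exact ContDiff.const_smul (R := ℝ) _ (h6.comp h1)

end Smoothness

section LieGroup

open Bundle

variable {E : Type*} [NormedAddCommGroup E] [NormedSpace ℝ E]
  {G : Type*} [TopologicalSpace G] [ChartedSpace E G] [Group G] [LieGroup 𝓘(ℝ, E) ∞ G]

theorem contMDiff_tangentMap_mul :
    ContMDiff (𝓘(ℝ, E).tangent.prod 𝓘(ℝ, E).tangent) 𝓘(ℝ, E).tangent ∞
      fun p : TangentBundle 𝓘(ℝ, E) G × TangentBundle 𝓘(ℝ, E) G =>
        tangentMap (𝓘(ℝ, E).prod 𝓘(ℝ, E)) 𝓘(ℝ, E) (fun (p : G × G) ↦ p.1 * p.2)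
          ((equivTangentBundleProd 𝓘(ℝ, E) G 𝓘(ℝ, E) G).symm p) := by
  have S₂ : ContMDiff (𝓘(ℝ, E).tangent.prod 𝓘(ℝ, E).tangent) (𝓘(ℝ, E).prod 𝓘(ℝ, E)).tangent ∞
      (equivTangentBundleProd 𝓘(ℝ, E) G 𝓘(ℝ, E) G).symm := contMDiff_equivTangentBundleProd_symm
  have S₃ : ContMDiff (𝓘(ℝ, E).prod 𝓘(ℝ, E)).tangent 𝓘(ℝ, E).tangent ∞
      (tangentMap (𝓘(ℝ, E).prod 𝓘(ℝ, E)) 𝓘(ℝ, E) (fun (p : G × G) ↦ p.1 * p.2)) := by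
    apply ContMDiff.contMDiff_tangentMap _ (m := ∞) le_rfl
    exact contMDiff_mul 𝓘(ℝ, E) ∞
  exact S₃.comp S₂

theorem mfderiv_mul_apply (p : G × G) (u v : E) :
    mfderiv (𝓘(ℝ, E).prod 𝓘(ℝ, E)) 𝓘(ℝ, E) (fun q : G × G => q.1 * q.2) p (u, v) =
      (show E from mfderiv 𝓘(ℝ, E) 𝓘(ℝ, E) (fun h : G => h * p.2) p.1 u) +
        (show E from mfderiv 𝓘(ℝ, E) 𝓘(ℝ, E) (fun h : G => p.1 * h) p.2 v) :=
  mfderiv_prod_eq_add_apply (E := E) (E' := E) (E'' := E) (I := 𝓘(ℝ, E)) (I' := 𝓘(ℝ, E))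
    (I'' := 𝓘(ℝ, E)) (f := fun q : G × G => q.1 * q.2) (p := p) (v := (u, v))
    ((contMDiff_mul 𝓘(ℝ, E) ∞ (G := G)).mdifferentiableAt (by simp))

/-- The right-invariant vector field `g ↦ (d R_g)_1 X`. -/
def rightInvariant (X : GroupLieAlgebra 𝓘(ℝ, E) G) (g : G) : TangentSpace 𝓘(ℝ, E) g :=
  mfderiv 𝓘(ℝ, E) 𝓘(ℝ, E) (· * g) (1 : G) X

theorem contMDiff_rightInvariant (X : GroupLieAlgebra 𝓘(ℝ, E) G) :
    ContMDiff 𝓘(ℝ, E) (𝓘(ℝ, E).prod 𝓘(ℝ, E)) ∞ fun g : G =>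
      TotalSpace.mk' E g (rightInvariant X g) := by
  let fg : G → TangentBundle 𝓘(ℝ, E) G := fun g ↦ TotalSpace.mk' E g 0
  have sfg : ContMDiff 𝓘(ℝ, E) 𝓘(ℝ, E).tangent ∞ fg := contMDiff_zeroSection _ _
  let fv : G → TangentBundle 𝓘(ℝ, E) G := fun _ ↦ TotalSpace.mk' E 1 X
  have sfv : ContMDiff 𝓘(ℝ, E) 𝓘(ℝ, E).tangent ∞ fv := contMDiff_const
  have S := contMDiff_tangentMap_mul.comp (sfv.prodMk sfg)
  have h : (fun g : G => TotalSpace.mk' E g (rightInvariant X g)) =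
      (fun p : TangentBundle 𝓘(ℝ, E) G × TangentBundle 𝓘(ℝ, E) G =>
        tangentMap (𝓘(ℝ, E).prod 𝓘(ℝ, E)) 𝓘(ℝ, E) (fun (p : G × G) ↦ p.1 * p.2)
          ((equivTangentBundleProd 𝓘(ℝ, E) G 𝓘(ℝ, E) G).symm p)) ∘ fun g => (fv g, fg g) := by
    funext g
    refine TotalSpace.ext (one_mul g).symm ?_
    refine @heq_of_eq E _ _ ?_
    have h1 := mfderiv_mul_apply (E := E) ((1 : G), g) X 0
    refine Eq.trans ?_ h1.symm
    refine Eq.trans ?_ (congrArg₂ (fun a b : E => a + b) rfl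
      (ContinuousLinearMap.map_zero (M₁ := E) (M₂ := E) _).symm)
    exact (add_zero (M := E) _).symm
  rw [h]
  exact S

/-- The infinitesimal action of the Lie algebra associated with the action of `G` on itself by left
translations: `X` acts by the vector field `g ↦ d/dt exp(-t X) g |_{t = 0} = - (d R_g)_1 X`. The
sign makes it a homomorphism for the Lie bracket of left-invariant vector fields on `T_1 G`. -/
def leftAction : GroupLieAlgebra 𝓘(ℝ, E) G →ₗ[ℝ] VF E G where
  toFun X := - ⟨fun g => rightInvariant X g, contMDiff_rightInvariant X⟩
  map_add' X Y := by
    ext g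
    show -(mfderiv 𝓘(ℝ, E) 𝓘(ℝ, E) (· * g) (1 : G) (X + Y)) =
      -(mfderiv 𝓘(ℝ, E) 𝓘(ℝ, E) (· * g) (1 : G) X) + -(mfderiv 𝓘(ℝ, E) 𝓘(ℝ, E) (· * g) (1 : G) Y)
    rw [map_add, neg_add]
  map_smul' c X := by
    ext g
    show -(mfderiv 𝓘(ℝ, E) 𝓘(ℝ, E) (· * g) (1 : G) (c • X)) =
      c • -(mfderiv 𝓘(ℝ, E) 𝓘(ℝ, E) (· * g) (1 : G) X)
    rw [map_smul, smul_neg]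

theorem leftAction_apply (X : GroupLieAlgebra 𝓘(ℝ, E) G) (g : G) :
    leftAction X g = - rightInvariant X g := rfl

/-- The derivative at `g` of left translation by `g⁻¹`, as a map `T_g G → T_1 G`. -/
def toIdentity (g : G) : TangentSpace 𝓘(ℝ, E) g →L[ℝ] GroupLieAlgebra 𝓘(ℝ, E) G :=
  (mfderiv 𝓘(ℝ, E) 𝓘(ℝ, E) (fun h : G => g⁻¹ * h) g : E →L[ℝ] E)

/-- The coordinate expression of `toIdentity` in a chart. -/
def toIdentityRep (x₀ : G) (y : E) : E →L[ℝ] E :=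
  (show E →L[ℝ] E from toIdentity ((extChartAt 𝓘(ℝ, E) x₀).symm y)) ∘L
    (mfderiv 𝓘(ℝ, E) 𝓘(ℝ, E) (extChartAt 𝓘(ℝ, E) x₀).symm y)

theorem contDiffOn_toIdentityRep [FiniteDimensional ℝ E] (x₀ : G) :
    ContDiffOn ℝ ∞ (toIdentityRep x₀) (extChartAt 𝓘(ℝ, E) x₀).target := by
  rw [contDiffOn_clm_apply]
  intro w
  set s := (extChartAt 𝓘(ℝ, E) x₀).target with hs
  have ho : IsOpen s := isOpen_target (E := E) x₀
  have c1 : ContMDiffOn 𝓘(ℝ, E) 𝓘(ℝ, E) ∞ (extChartAt 𝓘(ℝ, E) x₀).symm s :=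
    contMDiffOn_extChartAt_symm x₀
  let f0 : E → TangentBundle 𝓘(ℝ, E) E := fun y => TotalSpace.mk' E y w
  have s0 : ContMDiff 𝓘(ℝ, E) 𝓘(ℝ, E).tangent ∞ f0 :=
    contMDiff_vectorSpace_iff_contDiff.2 contDiff_const
  let f1 : E → TangentBundle 𝓘(ℝ, E) G :=
    fun y => tangentMapWithin 𝓘(ℝ, E) 𝓘(ℝ, E) (extChartAt 𝓘(ℝ, E) x₀).symm s (f0 y)
  have s1 : ContMDiffOn 𝓘(ℝ, E) 𝓘(ℝ, E).tangent ∞ f1 s :=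
    (c1.contMDiffOn_tangentMapWithin (m := ∞) (by simp) ho.uniqueMDiffOn).comp s0.contMDiffOn
      (fun y hy => hy)
  let f2 : E → TangentBundle 𝓘(ℝ, E) G :=
    fun y => TotalSpace.mk' E ((extChartAt 𝓘(ℝ, E) x₀).symm y)⁻¹ 0
  have s2 : ContMDiffOn 𝓘(ℝ, E) 𝓘(ℝ, E).tangent ∞ f2 s :=
    (contMDiff_zeroSection (IB := 𝓘(ℝ, E)) (n := ∞) ℝ (TangentSpace 𝓘(ℝ, E) (M := G))).comp_contMDiffOn
      ((contMDiff_inv 𝓘(ℝ, E) ∞).comp_contMDiffOn c1)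
  have s3 := contMDiff_tangentMap_mul.comp_contMDiffOn (s2.prodMk s1)
  have s4 : ContMDiffOn 𝓘(ℝ, E) 𝓘(ℝ, E).tangent ∞
      (fun y => (TotalSpace.mk' E (1 : G) (toIdentityRep (E := E) x₀ y w) : TangentBundle 𝓘(ℝ, E) G)) s := by
    refine s3.congr fun y hy => ?_
    refine TotalSpace.ext (inv_mul_cancel _).symm ?_
    refine @heq_of_eq E _ _ ?_
    have h1 := mfderiv_mul_apply (E := E)
      (((extChartAt 𝓘(ℝ, E) x₀).symm y)⁻¹, (extChartAt 𝓘(ℝ, E) x₀).symm y) 0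
      (mfderivWithin 𝓘(ℝ, E) 𝓘(ℝ, E) (extChartAt 𝓘(ℝ, E) x₀).symm s y w)
    refine Eq.trans ?_ h1.symm
    rw [mfderivWithin_of_isOpen ho hy]
    refine Eq.trans ?_ (congrArg₂ (fun a b : E => a + b)
      (ContinuousLinearMap.map_zero (M₁ := E) (M₂ := E) _).symm rfl)
    exact (zero_add (M := E) _).symm
  intro y hy
  have s5 := (contMDiffWithinAt_totalSpace.1 (s4 y hy)).2
  rw [contMDiffWithinAt_iff_contDiffWithinAt] at s5
  refine s5.congr_of_mem (fun z hz => ?_) hy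
  exact ((tangentBundleCore 𝓘(ℝ, E) G).coordChange_self (achart E (1 : G)) 1
    (mem_chart_source E (1 : G)) _).symm

variable [CompleteSpace E] [FiniteDimensional ℝ E]

variable (E G) in
/-- The Cartan form as a continuous alternating map on `T_1 G`. -/
def cartanAtOne : GroupLieAlgebra 𝓘(ℝ, E) G [⋀^Fin 3]→L[ℝ] ℝ :=
  toContinuousAlternating (E := E) (cartan3 (GroupLieAlgebra 𝓘(ℝ, E) G))

variable (E G) in
/-- The left-invariant `3`-form on `G` which extends the Cartan form `⟨X, [Y, Z]⟩` on `T_1 G`. -/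
def cartanForm : Forms E G 3 :=
  ⟨fun g => (cartanAtOne E G).compContinuousLinearMap (toIdentity g), fun x₀ =>
    (contDiff_pullback (E := E) 3).comp_contDiffOn
      ((contDiffOn_const (c := toContinuousAlternating (E := E)
        (cartan3 (GroupLieAlgebra 𝓘(ℝ, E) G)))).prodMk (contDiffOn_toIdentityRep x₀))⟩

theorem cartanForm_apply (g : G) (u v w : TangentSpace 𝓘(ℝ, E) g) :
    (cartanForm E G).1 g ![u, v, w] =
      killingForm ℝ (GroupLieAlgebra 𝓘(ℝ, E) G) (toIdentity g u)
        ⁅toIdentity g v, toIdentity g w⁆ := rfl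

end LieGroup

end Multisymplectic

end

open Multisymplectic

/-! Everything is tested on the vector fields `ζ(X)` of the left action. They span every tangent
space. Moreover `ω` is constant on them: left translation to the identity carries `ζ(X)(g)` to
`-Ad(g⁻¹) X`, and `Ad(g⁻¹)` is a Lie algebra automorphism, hence preserves the Killing form, so
`ω(ζX, ζY, ζZ) = -⟨X, [Y, Z]⟩` at every point (`cartanForm_leftAction`). Since `ζ` is a
homomorphism, the invariant formula for `d` shows that on forms with constant values on these fields
`d` is the Chevalley-Eilenberg differential of the values (`extD_apply_of_const`). Thus `dω = 0`
reduces to `δω_e = 0`, which is invariance of the Killing form together with the Jacobi identity.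

The positive statements come from a single object, the linear family of one-forms `η(X)` with
`η(X)(ζW) = ⟨X, W⟩` (`exists_killing_oneForm`). The same principle gives `dη(X) = ι_{ζX} ω`, and
invariance of the Killing form gives `η([X, Y]) = -ι_{ζY} ι_{ζX} ω`. In other words `g_1 = dη` and
`g_2 = δη`, while `g_3 = ω_e ⊗ 1` by constancy. Hence `X ↦ (ζX, -ηX)` is a weak lift, `h_1` and
`h_2` vanish, and `Dη = γ - ω_e ⊗ 1`.

The negative statements all reduce to `ω_e ≠ δb` (`cartan3_ne_ceD`). A primitive `b` can be written
as `⟨φX, Y⟩` with `φ` skew, and `δb = ω_e` becomes `ad(φX) + [ad X, φ] = ad X`. Multiplying by `ad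
X` and taking traces gives `⟨X, X⟩ = ⟨φX, X⟩ = 0`, so the Killing form vanishes, which contradicts
Cartan's criterion. A homotopy co-moment map, a trivialization of `h_3` or a total primitive of `γ`
would each give a function-valued 2-cochain with differential `±ω_e ⊗ 1`; evaluation at one point
turns it into a real primitive of `ω_e`. -/

noncomputable section

namespace Multisymplectic

/-! ### The Cartan 3-cocycle of a simple Lie algebra. -/

section SimpleLie

open LieAlgebra

variable {L : Type*} [LieRing L] [LieAlgebra ℝ L]

theorem killing_lie (X Y Z : L) : killingForm ℝ L ⁅X, Y⁆ Z = killingForm ℝ L X ⁅Y, Z⁆ :=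
  LieModule.traceForm_apply_lie_apply ℝ L L X Y Z

theorem killing_comm (X Y : L) : killingForm ℝ L X Y = killingForm ℝ L Y X :=
  LieModule.traceForm_comm ℝ L L X Y

/-- Cartan's criterion in characteristic zero. -/
theorem isKilling_of_isSimple [Module.Finite ℝ L] (h : LieAlgebra.IsSimple ℝ L) : IsKilling ℝ L := by
  infer_instance

/-- The derived algebra is an ideal, and it is nonzero because a simple algebra is not abelian. -/
theorem span_lie_eq_top (h : LieAlgebra.IsSimple ℝ L) :
    Submodule.span ℝ {Z : L | ∃ X Y : L, ⁅X, Y⁆ = Z} = ⊤ := by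
  have h1 := LieSubmodule.lieIdeal_oper_eq_linear_span' (R := ℝ) (L := L) (M := L) (I := ⊤) (N := ⊤)
  rcases h.eq_bot_or_eq_top ⁅(⊤ : LieIdeal ℝ L), (⊤ : LieIdeal ℝ L)⁆ with h2 | h2
  · refine absurd ⟨fun X Y => ?_⟩ h.non_abelian
    have := LieSubmodule.lie_mem_lie (LieSubmodule.mem_top (R := ℝ) (L := L) X)
      (LieSubmodule.mem_top (R := ℝ) (L := L) Y)
    rw [h2] at this
    exact (LieSubmodule.mem_bot _).1 this
  · rw [h2] at h1
    simpa using h1.symm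

theorem ceD_three_apply {V : Type*} [AddCommGroup V] [Module ℝ V] (f : L [⋀^Fin 3]→ₗ[ℝ] V)
    (X : Fin 4 → L) : ceD L V 3 f X =
      - f ![⁅X 0, X 1⁆, X 2, X 3] + f ![⁅X 0, X 2⁆, X 1, X 3] - f ![⁅X 0, X 3⁆, X 1, X 2]
      - f ![⁅X 1, X 2⁆, X 0, X 3] + f ![⁅X 1, X 3⁆, X 0, X 2] - f ![⁅X 2, X 3⁆, X 0, X 1] := by
  have h : ∀ (i : Fin 3) (g : Fin 3 → V), ∑ j ≥ i, g j = ∑ j, if i ≤ j then g j else 0 :=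
    fun i g => by rw [← Finset.sum_filter]; congr 1; ext j; simp
  have r (i j : Fin 3) : j.removeNth (i.castSucc.removeNth X) =
      ![X (i.castSucc.succAbove (j.succAbove 0)), X (i.castSucc.succAbove (j.succAbove 1))] := by
    funext k; fin_cases k <;> rfl
  rw [ceD_apply, Fin.sum_univ_three]
  simp only [h, r, Fin.sum_univ_three]
  norm_num [Fin.succAbove, Fin.le_def, Fin.lt_def]
  rw [if_neg (by decide)]
  change - f ![⁅X 0, X 1⁆, X 2, X 3] + f ![⁅X 0, X 2⁆, X 1, X 3] + - f ![⁅X 0, X 3⁆, X 1, X 2] +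
    (- f ![⁅X 1, X 2⁆, X 0, X 3] + f ![⁅X 1, X 3⁆, X 0, X 2]) + (0 + - f ![⁅X 2, X 3⁆, X 0, X 1]) = _
  abel

theorem ceD_two_apply {V : Type*} [AddCommGroup V] [Module ℝ V] (f : L [⋀^Fin 2]→ₗ[ℝ] V)
    (X : Fin 3 → L) : ceD L V 2 f X =
      - f ![⁅X 0, X 1⁆, X 2] + f ![⁅X 0, X 2⁆, X 1] - f ![⁅X 1, X 2⁆, X 0] := by
  have h : ∀ (i : Fin 2) (g : Fin 2 → V), ∑ j ≥ i, g j = ∑ j, if i ≤ j then g j else 0 :=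
    fun i g => by rw [← Finset.sum_filter]; congr 1; ext j; simp
  have r (i j : Fin 2) : j.removeNth (i.castSucc.removeNth X) =
      ![X (i.castSucc.succAbove (j.succAbove 0))] := by
    funext k; fin_cases k; rfl
  rw [ceD_apply, Fin.sum_univ_two]
  simp only [h, r, Fin.sum_univ_two]
  norm_num [Fin.succAbove, Fin.le_def, Fin.lt_def]
  abel

theorem ceD_one_apply {V : Type*} [AddCommGroup V] [Module ℝ V] (f : L [⋀^Fin 1]→ₗ[ℝ] V)
    (X : Fin 2 → L) : ceD L V 1 f X = - f ![⁅X 0, X 1⁆] := by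
  have r (v : Fin 1 → L) : v = ![v 0] := by funext i; fin_cases i; rfl
  have h : ∑ j ≥ (0 : Fin 1), (-1 : ℝ) ^ (((0 : Fin 1) : ℕ) + 1 + ((j : ℕ) + 2)) •
      f (Matrix.vecCons ⁅X (0 : Fin 1).castSucc, X j.succ⁆
        (j.removeNth ((0 : Fin 1).castSucc.removeNth X))) = - f ![⁅X 0, X 1⁆] := by
    rw [Finset.sum_eq_single (0 : Fin 1) (fun j _ hj => absurd (Subsingleton.elim j 0) hj) (by simp),
      r (Matrix.vecCons _ _)]
    norm_num
  rw [ceD_apply, Fin.sum_univ_one]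
  exact h

/-- Invariance and symmetry of the Killing form bring each of the six terms to the shape `⟨X 0, ·⟩`;
they coincide in pairs, and the sum is twice a Jacobi identity in `X 1`, `X 2`, `X 3`. -/
theorem ceD_cartan3 : ceD L ℝ 3 (cartan3 L) = 0 := by
  ext X
  rw [ceD_three_apply]
  simp only [cartan3_apply, AlternatingMap.zero_apply]
  have h1 : killingForm ℝ L ⁅X 0, X 2⁆ ⁅X 1, X 3⁆ = killingForm ℝ L (X 0) ⁅X 2, ⁅X 1, X 3⁆⁆ :=
    killing_lie _ _ _
  rw [killing_lie, killing_lie, killing_lie, killing_comm ⁅X 1, X 2⁆, killing_comm ⁅X 1, X 3⁆,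
    killing_comm ⁅X 2, X 3⁆, killing_lie, killing_lie, killing_lie]
  have h2 : ⁅X 3, ⁅X 1, X 2⁆⁆ = ⁅X 1, ⁅X 3, X 2⁆⁆ + ⁅⁅X 3, X 1⁆, X 2⁆ := by
    rw [lie_lie (X 3) (X 1) (X 2)]; abel
  have h3 : ⁅⁅X 3, X 1⁆, X 2⁆ = ⁅X 2, ⁅X 1, X 3⁆⁆ := by
    rw [← lie_skew, ← lie_skew (X 1), lie_neg]
  rw [h2, h3, ← lie_skew (X 3) (X 2)]
  simp only [lie_neg, map_neg, map_add]
  ring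

/-- A primitive of the Cartan form would force the Killing form to vanish, by a trace argument. This
is the source of every non-vanishing statement. -/
theorem cartan3_ne_ceD [Module.Finite ℝ L] (h : LieAlgebra.IsSimple ℝ L) (b : L [⋀^Fin 2]→ₗ[ℝ] ℝ) :
    ceD L ℝ 2 b ≠ cartan3 L := by
  have := isKilling_of_isSimple h
  intro hb
  have hswap (X Y : L) : b ![Y, X] = - b ![X, Y] := by
    have h1 := b.map_swap ![X, Y] (i := 0) (j := 1) (by decide)
    rw [← h1]; congr 1; funext i; fin_cases i <;> rfl
  have hadd (X X' Y : L) : b ![X + X', Y] = b ![X, Y] + b ![X', Y] :=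
    congrArg (fun T : L [⋀^Fin 1]→ₗ[ℝ] ℝ => T ![Y]) (b.curryLeft.map_add X X')
  have hsmul (c : ℝ) (X Y : L) : b ![c • X, Y] = c • b ![X, Y] :=
    congrArg (fun T : L [⋀^Fin 1]→ₗ[ℝ] ℝ => T ![Y]) (b.curryLeft.map_smul c X)
  let B : L →ₗ[ℝ] L →ₗ[ℝ] ℝ := LinearMap.mk₂ ℝ (fun X Y => b ![X, Y]) hadd hsmul
    (fun X Y Y' => by rw [hswap _ X, hadd, hswap X, hswap X]; ring)
    (fun c X Y => by rw [hswap _ X, hsmul, hswap X]; simp)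
  -- Nondegeneracy turns the bilinear form `b` into an endomorphism `φ`, which is skew because `b`
  -- is alternating.
  let κ := (killingForm ℝ L).toDual (IsKilling.killingForm_nondegenerate ℝ L)
  let φ : L →ₗ[ℝ] L := κ.symm.toLinearMap ∘ₗ B
  have hφ (X Y : L) : killingForm ℝ L (φ X) Y = b ![X, Y] :=
    LinearMap.BilinForm.apply_toDual_symm_apply (hB := IsKilling.killingForm_nondegenerate ℝ L) (B X) Y
  have hsk (X Y : L) : killingForm ℝ L (φ X) Y = - killingForm ℝ L X (φ Y) := by
    rw [killing_comm X, hφ, hφ, hswap]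
  -- This is the equation `δb = ω_e`, paired with `Z` through the Killing form and freed of `Y` and
  -- `Z`.
  have key (X : L) : ad ℝ L (φ X) + (ad ℝ L X ∘ₗ φ - φ ∘ₗ ad ℝ L X) = ad ℝ L X := by
    ext Y
    refine κ.injective (LinearMap.ext fun Z => ?_)
    have h1 := congrArg (fun f : L [⋀^Fin 3]→ₗ[ℝ] ℝ => f ![X, Y, Z]) hb
    simp only [ceD_two_apply, cartan3_apply] at h1
    have h2 : killingForm ℝ L ⁅φ X, Y⁆ Z = b ![X, ⁅Y, Z⁆] := by rw [killing_lie, hφ]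
    have h3 : killingForm ℝ L ⁅X, φ Y⁆ Z = - b ![Y, ⁅X, Z⁆] := by
      rw [← lie_skew, map_neg, LinearMap.neg_apply, killing_lie, hφ]
    have h4 : killingForm ℝ L (φ ⁅X, Y⁆) Z = b ![⁅X, Y⁆, Z] := hφ _ _
    show killingForm ℝ L (⁅φ X, Y⁆ + (⁅X, φ Y⁆ - φ ⁅X, Y⁆)) Z = killingForm ℝ L ⁅X, Y⁆ Z
    rw [map_add, map_sub, LinearMap.add_apply, LinearMap.sub_apply, h2, h3, h4, killing_lie X, ← h1,
      hswap _ X, hswap _ Y]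
    simp
    ring
  -- Compose `key` with `ad X` and take traces: the commutator term drops out by cyclicity, and the
  -- first term is `⟨φX, X⟩`, which is zero by skewness.
  have hzero (X : L) : killingForm ℝ L X X = 0 := by
    have h1 : killingForm ℝ L (φ X) X = 0 := by
      have := hsk X X
      rw [killing_comm X] at this
      linarith
    rw [killingForm_apply_apply] at h1 ⊢
    have h2 := congrArg (fun T => LinearMap.trace ℝ L (T ∘ₗ ad ℝ L X)) (key X)
    simp only [LinearMap.add_comp, LinearMap.sub_comp, map_add, map_sub, h1] at h2
    rw [← h2, LinearMap.comp_assoc, LinearMap.trace_comp_comm']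
    simp [LinearMap.comp_assoc]
  have hall (X Y : L) : killingForm ℝ L X Y = 0 := by
    have h1 := hzero (X + Y)
    simp only [map_add, LinearMap.add_apply, hzero, killing_comm Y X] at h1
    linarith
  refine h.non_abelian ⟨fun X Y => ?_⟩
  have h2 := IsKilling.ker_killingForm_eq_bot ℝ L
  exact (Submodule.mem_bot ℝ).1 (h2 ▸ LinearMap.mem_ker.2 (LinearMap.ext (hall _)))

/-- Such an `X` is orthogonal to all brackets. These span the algebra, so `X` lies in the radical of
the Killing form. -/
theorem cartan3_nondegenerate [Module.Finite ℝ L] (h : LieAlgebra.IsSimple ℝ L) {X : L}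
    (hX : ∀ Y Z, cartan3 L ![X, Y, Z] = 0) : X = 0 := by
  have := isKilling_of_isSimple h
  have h1 : killingForm ℝ L X = 0 := by
    refine LinearMap.ext_on_range (v := fun p : L × L => ⁅p.1, p.2⁆) ?_ fun p => hX p.1 p.2
    rw [← span_lie_eq_top h]
    congr 1; ext Z; simp
  have h2 := IsKilling.ker_killingForm_eq_bot ℝ L
  exact (Submodule.mem_bot ℝ).1 (h2 ▸ LinearMap.mem_ker.2 h1)

theorem cartan3_equiv (e : L ≃ₗ⁅ℝ⁆ L) (X : Fin 3 → L) :
    cartan3 L (fun i => e (X i)) = cartan3 L X := by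
  show killingForm ℝ L (e (X 0)) ⁅e (X 1), e (X 2)⁆ = killingForm ℝ L (X 0) ⁅X 1, X 2⁆
  rw [← LieEquiv.map_lie, killingForm_of_equiv_apply]

end SimpleLie

open VectorField

/-! ### Derivatives of diffeomorphisms and brackets of related vector fields. -/

section Translations

variable {E : Type*} [NormedAddCommGroup E] [NormedSpace ℝ E]
  {G : Type*} [TopologicalSpace G] [ChartedSpace E G]

/-- The derivative of a map `G → G`, all tangent spaces being identified with the model space. -/
def tderiv (f : G → G) (x : G) : E →L[ℝ] E := mfderiv 𝓘(ℝ, E) 𝓘(ℝ, E) f x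

theorem tderiv_comp {f g : G → G} (hg : ContMDiff 𝓘(ℝ, E) 𝓘(ℝ, E) ∞ g)
    (hf : ContMDiff 𝓘(ℝ, E) 𝓘(ℝ, E) ∞ f) (x : G) (u : E) :
    tderiv (fun y => g (f y)) x u = tderiv g (f x) (tderiv f x u) :=
  mfderiv_comp_apply (I := 𝓘(ℝ, E)) (I' := 𝓘(ℝ, E)) (I'' := 𝓘(ℝ, E)) x
    (hg.mdifferentiable (by simp) _) (hf.mdifferentiable (by simp) _) u

theorem tderiv_id (x : G) (u : E) : tderiv (fun y : G => y) x u = u := by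
  show mfderiv 𝓘(ℝ, E) 𝓘(ℝ, E) id x u = u
  rw [mfderiv_id]; rfl

theorem tderiv_of_leftInverse {f g : G → G} (hg : ContMDiff 𝓘(ℝ, E) 𝓘(ℝ, E) ∞ g)
    (hf : ContMDiff 𝓘(ℝ, E) 𝓘(ℝ, E) ∞ f) (h : Function.LeftInverse g f) (x : G) (u : E) :
    tderiv g (f x) (tderiv f x u) = u := by
  rw [← tderiv_comp hg hf, show (fun y => g (f y)) = fun y => y from funext h, tderiv_id]

/-- A diffeomorphism maps the bracket of two vector fields to the bracket of their images. -/
theorem tderiv_mlieBracket [CompleteSpace E] [IsManifold 𝓘(ℝ, E) ∞ G] {f f' : G → G}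
    (hf : ContMDiff 𝓘(ℝ, E) 𝓘(ℝ, E) ∞ f) (hf' : ContMDiff 𝓘(ℝ, E) 𝓘(ℝ, E) ∞ f')
    (hl : Function.LeftInverse f' f) (hr : Function.RightInverse f' f) {U₁ U₂ V₁ V₂ : G → E}
    (h₁ : ∀ x, tderiv f x (U₁ x) = V₁ (f x)) (h₂ : ∀ x, tderiv f x (U₂ x) = V₂ (f x))
    (hV₁ : ∀ x, MDifferentiableAt 𝓘(ℝ, E) (𝓘(ℝ, E).prod 𝓘(ℝ, E))
      (fun x => (Bundle.TotalSpace.mk' E x (V₁ x) : TangentBundle 𝓘(ℝ, E) G)) x)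
    (hV₂ : ∀ x, MDifferentiableAt 𝓘(ℝ, E) (𝓘(ℝ, E).prod 𝓘(ℝ, E))
      (fun x => (Bundle.TotalSpace.mk' E x (V₂ x) : TangentBundle 𝓘(ℝ, E) G)) x)
    (x y : G) (hy : f x = y) :
    tderiv (E := E) f x (mlieBracket 𝓘(ℝ, E) (V := U₁) (W := U₂) x) =
      mlieBracket 𝓘(ℝ, E) (V := V₁) (W := V₂) y := by
  -- The image point is a separate variable so that it can be given in simplified form, such as `1`
  -- for `a⁻¹ * (1 * a)`, without transport between tangent spaces.
  subst hy
  have hr' (x : G) (u : E) : tderiv f x (tderiv f' (f x) u) = u := by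
    have := tderiv_of_leftInverse hf hf' hr (f x) u
    rwa [hl x] at this
  have hinv (x : G) : (tderiv (E := E) f x).inverse = tderiv f' (f x) :=
    ContinuousLinearMap.inverse_eq (ContinuousLinearMap.ext fun u => hr' x u)
      (ContinuousLinearMap.ext fun u => tderiv_of_leftInverse hf' hf hl x u)
  -- For a diffeomorphism, being related by `f` is the same as being the pullback under `f`, and
  -- pullback is known to respect brackets.
  have hpull {U V : G → E} (h : ∀ x, tderiv f x (U x) = V (f x)) :
      mpullback 𝓘(ℝ, E) 𝓘(ℝ, E) f (V := V) = U := by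
    funext x
    refine (congrArg (fun T : E →L[ℝ] E => T (V (f x))) (hinv x)).trans ?_
    show tderiv f' (f x) (V (f x)) = U x
    rw [← h, tderiv_of_leftInverse hf' hf hl]
  have key := mpullback_mlieBracket (I := 𝓘(ℝ, E)) (I' := 𝓘(ℝ, E)) (n := ∞) (f := f) (x₀ := x)
    (hV₁ _) (hV₂ _) hf.contMDiffAt
    (by rw [minSmoothness_of_isRCLikeNormedField]; exact ENat.LEInfty.out)
  rw [hpull h₁, hpull h₂] at key
  have key' : tderiv (E := E) f' (f x) (mlieBracket 𝓘(ℝ, E) (V := V₁) (W := V₂) (f x)) =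
      mlieBracket 𝓘(ℝ, E) (V := U₁) (W := U₂) x :=
    (congrArg (fun T : E →L[ℝ] E => T (mlieBracket 𝓘(ℝ, E) (V := V₁) (W := V₂) (f x)))
      (hinv x)).symm.trans key
  exact (congrArg (tderiv (E := E) f x) key').symm.trans (hr' x _)

end Translations

/-! ### Translations, conjugation, inversion and the Cartan form on the group. -/

section LieGroup

variable {E : Type*} [NormedAddCommGroup E] [NormedSpace ℝ E]
  {G : Type*} [TopologicalSpace G] [ChartedSpace E G] [Group G] [LieGroup 𝓘(ℝ, E) ∞ G]

theorem contMDiff_left (a : G) : ContMDiff 𝓘(ℝ, E) 𝓘(ℝ, E) ∞ (fun h : G => a * h) :=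
  contMDiff_mul_left

theorem contMDiff_right (a : G) : ContMDiff 𝓘(ℝ, E) 𝓘(ℝ, E) ∞ (fun h : G => h * a) :=
  contMDiff_mul_right

theorem contMDiff_conj (a : G) : ContMDiff 𝓘(ℝ, E) 𝓘(ℝ, E) ∞ (fun h : G => a⁻¹ * (h * a)) :=
  (contMDiff_left _).comp (contMDiff_right a)

theorem contMDiff_inversion : ContMDiff 𝓘(ℝ, E) 𝓘(ℝ, E) ∞ (fun h : G => h⁻¹) :=
  contMDiff_inv _ _

/-- Differentiate `h * h⁻¹ = 1` at the identity with the product rule. -/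
theorem tderiv_inv_one (u : E) : tderiv (fun h : G => h⁻¹) 1 u = - u := by
  have hinv := (contMDiff_inversion (E := E) (G := G)).mdifferentiable (by simp) 1
  have h1 := mfderiv_comp_apply (I := 𝓘(ℝ, E)) (I' := 𝓘(ℝ, E).prod 𝓘(ℝ, E)) (I'' := 𝓘(ℝ, E))
    (g := fun p : G × G => p.1 * p.2) (f := fun h : G => (h, h⁻¹)) 1
    ((contMDiff_mul 𝓘(ℝ, E) ∞ (G := G)).mdifferentiableAt (by simp))
    (mdifferentiableAt_id.prodMk hinv) u
  have h2 := mfderiv_mul_apply (E := E) ((1 : G), (1 : G)⁻¹) u (tderiv (fun h : G => h⁻¹) 1 u)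
  have h3 : (mfderiv 𝓘(ℝ, E) (𝓘(ℝ, E).prod 𝓘(ℝ, E)) (fun h : G => (h, h⁻¹)) 1 u : E × E) =
      (u, tderiv (fun h : G => h⁻¹) 1 u) := by
    have h4 := mfderiv_prodMk (I := 𝓘(ℝ, E)) (I' := 𝓘(ℝ, E)) (I'' := 𝓘(ℝ, E))
      (f := fun h : G => h) mdifferentiableAt_id hinv
    refine (congrArg (fun T : E →L[ℝ] E × E => T u) h4).trans ?_
    exact Prod.ext (tderiv_id (1 : G) u) rfl
  have h4 : mfderiv 𝓘(ℝ, E) 𝓘(ℝ, E) ((fun p : G × G => p.1 * p.2) ∘ fun h : G => (h, h⁻¹)) 1 =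
      (0 : E →L[ℝ] E) := by
    rw [show ((fun p : G × G => p.1 * p.2) ∘ fun h : G => (h, h⁻¹)) = fun _ => 1 from
      funext fun h => mul_inv_cancel h]
    exact mfderiv_const
  have h5 : tderiv (fun h : G => h * (1 : G)⁻¹) 1 u = u := by
    rw [show (fun h : G => h * (1 : G)⁻¹) = fun h => h by simp, tderiv_id]
  have h6 (v : E) : tderiv (fun h : G => 1 * h) (1 : G)⁻¹ v = v := by
    rw [show (fun h : G => 1 * h) = fun h => h by simp, tderiv_id]
  have h7 : (0 : E) = tderiv (fun h : G => h * (1 : G)⁻¹) 1 u +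
      tderiv (fun h : G => 1 * h) (1 : G)⁻¹ (tderiv (fun h : G => h⁻¹) 1 u) := by
    refine Eq.trans ?_ h2
    refine Eq.trans (congrArg (fun T : E →L[ℝ] E => T u) h4).symm (h1.trans ?_)
    exact congrArg (fun p : E × E => (mfderiv (𝓘(ℝ, E).prod 𝓘(ℝ, E)) 𝓘(ℝ, E)
      (fun q : G × G => q.1 * q.2) ((1 : G), (1 : G)⁻¹) : E × E →L[ℝ] E) p) h3
  rw [h5, h6] at h7
  exact (neg_eq_of_add_eq_zero_right h7.symm).symm

/-- The derivative at `1` of the conjugation `h ↦ a⁻¹ h a`. -/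
def conjDeriv (a : G) : GroupLieAlgebra 𝓘(ℝ, E) G →ₗ[ℝ] GroupLieAlgebra 𝓘(ℝ, E) G :=
  (tderiv (E := E) (fun h : G => a⁻¹ * (h * a)) 1).toLinearMap

/-- In the left trivialization a right-invariant field is not constant: its value at `g` is `Ad(g⁻¹)
X`. -/
theorem toIdentity_rightInvariant (X : GroupLieAlgebra 𝓘(ℝ, E) G) (g : G) :
    toIdentity g (rightInvariant X g) = conjDeriv g X := by
  have h := tderiv_comp (contMDiff_left (E := E) g⁻¹) (contMDiff_right g) 1 X
  rw [one_mul] at h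
  exact h.symm

theorem toIdentity_left (a g : G) (u : E) :
    toIdentity (a * g) (tderiv (E := E) (fun h : G => a * h) g u) = toIdentity (E := E) g u := by
  have h := tderiv_comp (contMDiff_left (E := E) (a * g)⁻¹) (contMDiff_left a) g u
  refine h.symm.trans ?_
  rw [show (fun h : G => (a * g)⁻¹ * (a * h)) = fun h => g⁻¹ * h by funext h; group]
  rfl

/-- From `(g a)⁻¹ (h a) = a⁻¹ (g⁻¹ h) a`: right translation acts in the left trivialization through
conjugation, so right invariance of `ω` becomes `Ad`-invariance of `ω_e`. -/
theorem toIdentity_right (a g : G) (u : E) :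
    toIdentity (g * a) (tderiv (E := E) (fun h : G => h * a) g u) =
      conjDeriv a (toIdentity (E := E) g u) := by
  have h := tderiv_comp (contMDiff_left (E := E) (g * a)⁻¹) (contMDiff_right a) g u
  have h2 := tderiv_comp (contMDiff_conj (E := E) a) (contMDiff_left g⁻¹) g u
  rw [inv_mul_cancel] at h2
  refine h.symm.trans (Eq.trans ?_ h2)
  rw [show (fun h : G => (g * a)⁻¹ * (h * a)) = fun h => a⁻¹ * (g⁻¹ * h * a) by funext h; group]

theorem toIdentity_injective (g : G) : Function.Injective (toIdentity (E := E) g) :=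
  Function.LeftInverse.injective (g := tderiv (E := E) (fun h : G => g * h) (g⁻¹ * g)) fun u =>
    tderiv_of_leftInverse (contMDiff_left g) (contMDiff_left g⁻¹) (mul_inv_cancel_left g) g u

theorem toIdentity_surjective (g : G) : Function.Surjective (toIdentity (E := E) g) := fun u => by
  have h := tderiv_of_leftInverse (contMDiff_left (E := E) g⁻¹) (contMDiff_left g)
    (inv_mul_cancel_left g) 1 u
  rw [mul_one] at h
  exact ⟨_, h⟩

theorem rightInvariant_surjective (g : G) (u : E) :
    ∃ X : GroupLieAlgebra 𝓘(ℝ, E) G, rightInvariant X g = u := by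
  have h := tderiv_of_leftInverse (contMDiff_right (E := E) g) (contMDiff_right g⁻¹)
    (fun h => inv_mul_cancel_right h g) g u
  rw [mul_inv_cancel] at h
  exact ⟨_, h⟩

variable [CompleteSpace E]

theorem mdifferentiableAt_mulInvariant (X : GroupLieAlgebra 𝓘(ℝ, E) G) (x : G) :
    MDifferentiableAt 𝓘(ℝ, E) (𝓘(ℝ, E).prod 𝓘(ℝ, E))
      (fun x => (Bundle.TotalSpace.mk' E x (mulInvariantVectorField X x) :
        TangentBundle 𝓘(ℝ, E) G)) x :=
  mdifferentiableAt_mulInvariantVectorField X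

/-- Conjugation is a group automorphism, so it maps the left-invariant field of `X` to the
left-invariant field of `conjDeriv a X`; diffeomorphisms respect brackets of related fields. -/
theorem conjDeriv_lie (a : G) (X Y : GroupLieAlgebra 𝓘(ℝ, E) G) :
    conjDeriv a ⁅X, Y⁆ = ⁅conjDeriv a X, conjDeriv a Y⁆ := by
  have h (X : GroupLieAlgebra 𝓘(ℝ, E) G) (x : G) :
      tderiv (E := E) (fun h : G => a⁻¹ * (h * a)) x (mulInvariantVectorField X x) =
        mulInvariantVectorField (conjDeriv a X) (a⁻¹ * (x * a)) := by
    have h1 := tderiv_comp (contMDiff_conj (E := E) a) (contMDiff_left x) 1 X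
    have h2 := tderiv_comp (contMDiff_left (E := E) (a⁻¹ * (x * a))) (contMDiff_conj a) 1 X
    rw [mul_one] at h1
    rw [one_mul, inv_mul_cancel] at h2
    refine h1.symm.trans (Eq.trans ?_ h2)
    rw [show (fun h : G => a⁻¹ * (x * h * a)) = fun h => a⁻¹ * (x * a) * (a⁻¹ * (h * a)) by
      funext h; group]
  exact tderiv_mlieBracket (contMDiff_conj (E := E) a) (f' := fun h => a * (h * a⁻¹))
    ((contMDiff_left _).comp (contMDiff_right _)) (fun h => by group) (fun h => by group)
    (h X) (h Y) (mdifferentiableAt_mulInvariant _) (mdifferentiableAt_mulInvariant _) 1 1 (by group)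

/-- The automorphism of the Lie algebra induced by the conjugation `h ↦ a⁻¹ h a`. -/
def conjEquiv (a : G) : GroupLieAlgebra 𝓘(ℝ, E) G ≃ₗ⁅ℝ⁆ GroupLieAlgebra 𝓘(ℝ, E) G :=
  have h (a : G) (X : GroupLieAlgebra 𝓘(ℝ, E) G) : conjDeriv a⁻¹ (conjDeriv a X) = X := by
    have h1 := tderiv_of_leftInverse (contMDiff_conj (E := E) a⁻¹) (contMDiff_conj a)
      (fun h => by group) 1 X
    rw [one_mul, inv_mul_cancel] at h1
    exact h1
  { conjDeriv a with
    map_lie' := conjDeriv_lie a _ _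
    invFun := conjDeriv a⁻¹
    left_inv := h a
    right_inv := fun X => by simpa using h a⁻¹ X }

/-- Inversion maps the left-invariant field of `X` to `leftAction X`, because `(x h)⁻¹ = h⁻¹ x⁻¹`
and inversion has derivative `-1` at the identity. The bracket of `T_1 G` is that of left-invariant
fields, so it is carried over. -/
theorem leftAction_lie (X Y : GroupLieAlgebra 𝓘(ℝ, E) G) :
    leftAction ⁅X, Y⁆ = lieBr (leftAction X) (leftAction Y) := by
  have h (X : GroupLieAlgebra 𝓘(ℝ, E) G) (x : G) :
      tderiv (E := E) (fun h : G => h⁻¹) x (mulInvariantVectorField X x) = leftAction X x⁻¹ := by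
    have h1 := tderiv_comp (contMDiff_inversion (E := E)) (contMDiff_left x) 1 X
    have h2 := tderiv_comp (contMDiff_right (E := E) x⁻¹) contMDiff_inversion 1 X
    rw [mul_one] at h1
    have h3 : tderiv (E := E) (fun h : G => h * x⁻¹) (1 : G)⁻¹ (tderiv (fun h : G => h⁻¹) 1 X) =
        - tderiv (E := E) (fun h : G => h * x⁻¹) 1 X := by
      rw [inv_one]
      exact (congrArg _ (tderiv_inv_one (G := G) (E := E) X)).trans (map_neg _ _)
    refine h1.symm.trans (Eq.trans ?_ (h2.trans h3))
    rw [show (fun h : G => (x * h)⁻¹) = fun h => h⁻¹ * x⁻¹ by funext h; group]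
  ext g
  have h3 := tderiv_mlieBracket (contMDiff_inversion (E := E)) (f' := fun h : G => h⁻¹)
    contMDiff_inversion inv_inv inv_inv (h X) (h Y) (fun x => (leftAction X).mdifferentiableAt)
    (fun x => (leftAction Y).mdifferentiableAt) g⁻¹ g (inv_inv g)
  have h4 := h ⁅X, Y⁆ g⁻¹
  rw [inv_inv] at h4
  refine Eq.trans h4.symm (Eq.trans ?_ h3)
  exact congrArg (tderiv (E := E) (fun h : G => h⁻¹) g⁻¹)
    (congrFun (mulInvariantVector_mlieBracket X Y) g⁻¹)

variable [FiniteDimensional ℝ E]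

instance : FiniteDimensional ℝ (GroupLieAlgebra 𝓘(ℝ, E) G) := inferInstanceAs (FiniteDimensional ℝ E)

theorem cartanForm_eq (g : G) (u : Fin 3 → TangentSpace 𝓘(ℝ, E) g) :
    (cartanForm E G).1 g u =
      cartan3 (GroupLieAlgebra 𝓘(ℝ, E) G) fun i => toIdentity g (u i) := rfl

/-- The left trivialization gives `-Ad(g⁻¹) (X i)` in each slot. Automorphisms preserve the Cartan
form, and the three signs multiply to `-1`. This constancy drives the whole computation. -/
theorem cartanForm_leftAction (X : Fin 3 → GroupLieAlgebra 𝓘(ℝ, E) G) (g : G) :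
    (cartanForm E G).1 g (fun i => leftAction (X i) g) =
      - cartan3 (GroupLieAlgebra 𝓘(ℝ, E) G) X := by
  have h (X : GroupLieAlgebra 𝓘(ℝ, E) G) :
      toIdentity g (leftAction X g) = (-1 : ℝ) • conjEquiv g X := by
    rw [leftAction_apply, neg_one_smul]
    exact (map_neg (toIdentity (E := E) g) _).trans (congrArg Neg.neg (toIdentity_rightInvariant X g))
  rw [cartanForm_eq]
  simp only [h]
  rw [AlternatingMap.map_smul_univ]
  simp only [cartan3_equiv]
  norm_num

theorem cartanForm_pullback_left (a : G) :
    PullbackInvariant (fun g => a * g) (cartanForm E G) := fun g u => by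
  rw [cartanForm_eq, cartanForm_eq]
  exact congrArg _ (funext fun i => toIdentity_left (E := E) a g (u i))

theorem cartanForm_pullback_right (a : G) :
    PullbackInvariant (fun g => g * a) (cartanForm E G) := fun g u => by
  rw [cartanForm_eq, cartanForm_eq]
  exact (congrArg _ (funext fun i => toIdentity_right (E := E) a g (u i))).trans
    (cartan3_equiv (conjEquiv a) _)

theorem cartanForm_nondegenerate (hG : LieAlgebra.IsSimple ℝ (GroupLieAlgebra 𝓘(ℝ, E) G)) :
    Nondegenerate (cartanForm E G) := fun g v hv => by
  refine toIdentity_injective (E := E) g (Eq.trans ?_ (map_zero (toIdentity (E := E) g)).symm)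
  refine cartan3_nondegenerate hG fun Y Z => ?_
  obtain ⟨y, rfl⟩ := toIdentity_surjective g Y
  obtain ⟨z, rfl⟩ := toIdentity_surjective g Z
  exact hv ![y, z]

end LieGroup

/-! ### Exterior derivative of forms that are constant on an infinitesimal action. -/

section Invariant

variable {E : Type*} [NormedAddCommGroup E] [NormedSpace ℝ E] [CompleteSpace E]
  {M : Type*} [TopologicalSpace M] [ChartedSpace E M] [IsManifold 𝓘(ℝ, E) ∞ M] {k : ℕ}
  {L : Type*} [LieRing L] [LieAlgebra ℝ L]

/-- The coordinate expression of a vector field at the centre of the chart. -/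
theorem vecRep_center (v : (x : M) → TangentSpace 𝓘(ℝ, E) x) (x : M) :
    (mfderiv 𝓘(ℝ, E) 𝓘(ℝ, E) (extChartAt 𝓘(ℝ, E) x) x (v x) : E) =
      vecRep v x (extChartAt 𝓘(ℝ, E) x x) := by
  have h := mfderivWithin_extChartAt_symm_comp_mfderiv_extChartAt' (I := 𝓘(ℝ, E))
    (mem_extChartAt_source (I := 𝓘(ℝ, E)) x)
  simp only [modelWithCornersSelf_coe, Set.range_id, mfderivWithin_univ] at h
  have h1 : (mfderiv 𝓘(ℝ, E) 𝓘(ℝ, E) (extChartAt 𝓘(ℝ, E) x).symm (extChartAt 𝓘(ℝ, E) x x)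
      (mfderiv 𝓘(ℝ, E) 𝓘(ℝ, E) (extChartAt 𝓘(ℝ, E) x) x (v x)) : E) = v x :=
    congrArg (fun T : E →L[ℝ] E => T (v x)) h
  have h2 : (v ((extChartAt 𝓘(ℝ, E) x).symm (extChartAt 𝓘(ℝ, E) x x)) : E) = v x :=
    congrArg (fun y => (v y : E)) (extChartAt_to_inv (I := 𝓘(ℝ, E)) x)
  exact (inv_symm x (mem_extChartAt_target (I := 𝓘(ℝ, E)) x)).injective
    (h1.trans (h2.symm.trans (symm_vecRep v x (mem_extChartAt_target (I := 𝓘(ℝ, E)) x)).symm))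

theorem localRep_apply_vecRep (α : (x : M) → TangentSpace 𝓘(ℝ, E) x [⋀^Fin k]→L[ℝ] ℝ)
    (v : Fin k → (x : M) → TangentSpace 𝓘(ℝ, E) x) (x₀ : M) {y : E}
    (hy : y ∈ (extChartAt 𝓘(ℝ, E) x₀).target) :
    localRep α x₀ y (fun i => vecRep (v i) x₀ y) =
      α ((extChartAt 𝓘(ℝ, E) x₀).symm y) (fun i => v i ((extChartAt 𝓘(ℝ, E) x₀).symm y)) :=
  form_congr α rfl _ _ (funext fun i => symm_vecRep (v i) x₀ hy)

/-- If a form has constant values `f` on the vector fields of an infinitesimal action, then the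
values of its exterior derivative are those of the Chevalley-Eilenberg differential of `f`. -/
theorem extD_apply_of_const {ζ : L →ₗ[ℝ] VF E M} (hζ : ∀ X Y, ζ ⁅X, Y⁆ = lieBr (ζ X) (ζ Y))
    (α : Forms E M (k + 1)) (f : L [⋀^Fin (k + 1)]→ₗ[ℝ] ℝ)
    (hα : ∀ (X : Fin (k + 1) → L) x, α.1 x (fun i => ζ (X i) x) = f X) (X : Fin (k + 2) → L) (x : M) :
    (extD E M (k + 1) α).1 x (fun i => ζ (X i) x) = ceD L ℝ (k + 1) f X := by
  have hx := mem_extChartAt_target (I := 𝓘(ℝ, E)) x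
  have hn := (isOpen_target (E := E) x).mem_nhds hx
  set y := extChartAt 𝓘(ℝ, E) x x with hy
  let V : L → E → E := fun X => vecRep (fun x => ζ X x) x
  have hV (X : L) : DifferentiableAt ℝ (V X) y :=
    ((contDiffOn_vecRep (ζ X) x).contDiffAt hn).differentiableAt (by simp)
  have hconst (X : Fin (k + 1) → L) {z : E} (hz : z ∈ (extChartAt 𝓘(ℝ, E) x).target) :
      localRep α.1 x z (fun i => V (X i) z) = f X :=
    (localRep_apply_vecRep α.1 (fun i x => ζ (X i) x) x hz).trans (hα _ _)
  -- Since `ζ` is a homomorphism, the bracket of two coordinate fields is again a field of the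
  -- family.
  have hlie (X Y : L) : lieBracket ℝ (V X) (V Y) y = V ⁅X, Y⁆ y := by
    show _ = vecRep (fun x => ζ ⁅X, Y⁆ x) x y
    rw [hζ]
    exact (vecRep_bracket _ _ x).symm
  have hd : (extD E M (k + 1) α).1 x (fun i => ζ (X i) x) =
      extDeriv (localRep α.1 x) y (fun i => V (X i) y) :=
    congrArg (extDeriv (localRep α.1 x) y) (funext fun i => vecRep_center (fun x => ζ (X i) x) x)
  rw [hd, extDeriv_apply_vectorField (V := fun i => V (X i))
    (((α.2 x).contDiffAt hn).differentiableAt (by simp)) fun i => hV (X i), ceD_apply]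
  -- The terms of the invariant formula that differentiate values of the form vanish, since these
  -- values are constant near `y`. Only the bracket terms remain.
  have h0 (i : Fin (k + 2)) : fderiv ℝ (fun z => localRep α.1 x z
      (i.removeNth fun j => V (X j) z)) y = 0 := by
    have : (fun z => localRep α.1 x z (i.removeNth fun j => V (X j) z)) =ᶠ[nhds y]
        fun _ => f (i.removeNth X) := by
      filter_upwards [hn] with z hz using hconst (i.removeNth X) hz
    rw [this.fderiv_eq, fderiv_fun_const]; rfl
  simp only [h0, zero_apply, smul_zero, Finset.sum_const_zero, zero_sub,
    ← Finset.sum_neg_distrib]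
  refine Finset.sum_congr rfl fun i _ => Finset.sum_congr rfl fun j _ => ?_
  have h1 : (Matrix.vecCons (lieBracket ℝ (V (X i.castSucc)) (V (X j.succ)) y)
      (j.removeNth <| i.castSucc.removeNth fun l => V (X l) y)) = fun l => V (Matrix.vecCons
        ⁅X i.castSucc, X j.succ⁆ (j.removeNth (i.castSucc.removeNth X)) l) y := by
    rw [hlie]
    funext l
    exact Fin.cases rfl (fun _ => rfl) l
  -- The invariant formula subtracts terms with sign `(-1)^(i+j)`; the Chevalley-Eilenberg sign
  -- `(-1)^((i+1)+(j+2))` has the opposite parity and absorbs this minus.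
  rw [h1, hconst _ hx, ← neg_smul]
  rw [← Int.cast_smul_eq_zsmul ℝ]
  push_cast
  congr 1
  ring

variable (E M) in
theorem extD_constForm (c : ℝ) : extD E M 0 (constForm E M c) = 0 := by
  refine Subtype.ext (funext fun x => ?_)
  have h : extDeriv (localRep (constForm E M c).1 x) (extChartAt 𝓘(ℝ, E) x x) = 0 := by
    have : localRep (constForm E M c).1 x =
      fun _ => ContinuousAlternatingMap.constOfIsEmpty ℝ E (Fin 0) c := rfl
    rw [this]
    show ContinuousAlternatingMap.alternatizeUncurryFinCLM ℝ E ℝ (fderiv ℝ (fun _ => _) _) = 0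
    rw [fderiv_fun_const]
    exact map_zero (ContinuousAlternatingMap.alternatizeUncurryFinCLM ℝ E ℝ)
  ext u
  exact congrArg (fun T : E [⋀^Fin 1]→L[ℝ] ℝ => T fun i =>
    mfderiv 𝓘(ℝ, E) 𝓘(ℝ, E) (extChartAt 𝓘(ℝ, E) x) x (u i)) h

/-- The reason why identities between forms may be checked on the action fields alone. -/
theorem forms_ext_of_transitive {ζ : L →ₗ[ℝ] VF E M} 
    (hs : ∀ x (u : TangentSpace 𝓘(ℝ, E) x), ∃ X, ζ X x = u)
    {α β : Forms E M k} (h : ∀ (X : Fin k → L) x,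
      α.1 x (fun i => ζ (X i) x) = β.1 x (fun i => ζ (X i) x)) : α = β := by
  refine Subtype.ext (funext fun x => ?_)
  ext u
  choose X hX using fun i => hs x (u i)
  rw [← funext hX]
  exact h X x

end Invariant

/-! ### The function part of the third equation of an `L_∞`-morphism. -/

section Morphism

variable {E : Type*} [NormedAddCommGroup E] [NormedSpace ℝ E] [CompleteSpace E]
  {M : Type*} [TopologicalSpace M] [ChartedSpace E M] [IsManifold 𝓘(ℝ, E) ∞ M]
  {L : Type*} [LieRing L] [LieAlgebra ℝ L]

theorem isUnshuffle_two_iff (s : Equiv.Perm (Fin 3)) :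
    IsUnshuffle 2 s ↔ s = 1 ∨ s = Equiv.swap 1 2 ∨ s = finRotate 3 := by
  unfold IsUnshuffle
  revert s
  decide

theorem koszulSign_zero {n : ℕ} (s : Equiv.Perm (Fin n)) : koszulSign s (fun _ => 0) = 1 := by
  simp [koszulSign]

/-- With all blocks of size one, the condition on first entries says that the permutation is
increasing, hence trivial. -/
theorem isBlockUnshuffle_ones_iff {n : ℕ} (s : Equiv.Perm (Fin n)) :
    IsBlockUnshuffle (Composition.ones n) s ↔ s = 1 := by
  have e (j : Fin (Composition.ones n).length) := congrArg s
    (Composition.ones_embedding j ((Composition.ones n).blocks_pos' j j.2))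
  constructor
  · intro h
    have h1 : StrictMono s := fun i j hij => by
      have := h.2 ⟨i, by simp⟩ ⟨j, by simp⟩ hij (by simp)
      exact lt_of_eq_of_lt (e ⟨i, by simp⟩).symm (lt_of_lt_of_eq this (e ⟨j, by simp⟩))
    have := Subsingleton.elim (h1.orderIsoOfSurjective s s.surjective) (OrderIso.refl (Fin n))
    ext i
    exact congrArg (fun e : Fin n ≃o Fin n => (e i : ℕ)) this
  · rintro rfl
    exact ⟨fun j => (Composition.embedding _ j).strictMono, fun i j hij _ =>
      lt_of_eq_of_lt (e _) (lt_of_lt_of_eq hij (e _).symm)⟩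

theorem observables_br_snd {σ : Forms E M 3} (hσ : extD E M 3 σ = 0) {k : ℕ} (hk : k ≠ 3)
    (y : Fin k → Observables σ) : ((observables hσ).br k y).2 = 0 := by
  match k, hk with
  | 0, _ => rfl
  | 1, _ => rfl
  | 2, _ => rfl
  | k + 4, _ => rfl

theorem observables_br_three {σ : Forms E M 3} (hσ : extD E M 3 σ = 0)
    (y : Fin 3 → Observables σ) : ((observables hσ).br 3 y).2 =
      -(contr (y 2).1.1.1 (contr (y 1).1.1.1 (contr (y 0).1.1.1 σ))) := rfl

/-- The second component of an `L_∞`-morphism from a Lie algebra to the observables, as a cochain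
with values in functions. -/
def secondComponent {σ : Forms E M 3} {hσ : extD E M 3 σ = 0}
    (F : LInftyMorphism (lieBracketData L) (observables hσ)) : L [⋀^Fin 2]→ₗ[ℝ] Forms E M 0 where
  toMultilinearMap := (LinearMap.snd ℝ _ _).compMultilinearMap (F.f 2)
  map_eq_zero_of_eq' x i j h hij := by
    have h01 : x 0 = x 1 := by
      fin_cases i <;> fin_cases j <;> simp_all
    have h1 := F.skew 2 (by norm_num) (fun _ => 0) x (fun i => by simp [lieBracketData])
      (Equiv.swap 0 1)
    have h2 : x ∘ Equiv.swap 0 1 = x := by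
      funext i; fin_cases i <;> simp [h01]
    rw [h2, koszulSign_zero, Equiv.Perm.sign_swap (by decide), mul_one, Units.neg_smul, one_smul] at h1
    -- The rational structure makes the functions torsion-free, so that `y = -y` implies `y = 0`.
    have := Module.compHom (Forms E M 0) (algebraMap ℚ ℝ)
    have := IsAddTorsionFree.of_module_rat (Forms E M 0)
    exact self_eq_neg.1 (congrArg Prod.snd h1)

open Classical in
theorem sum_isUnshuffle {A : Type*} [AddCommMonoid A] (g : Equiv.Perm (Fin 3) → A) :
    ∑ s ∈ Finset.univ.filter (fun s : Equiv.Perm (Fin 3) => IsUnshuffle (1 + 1) s), g s =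
      g 1 + (g (Equiv.swap 1 2) + g (finRotate 3)) := by
  have h : (Finset.univ.filter fun s : Equiv.Perm (Fin 3) => IsUnshuffle (1 + 1) s) =
      {1, Equiv.swap 1 2, finRotate 3} := by
    ext s; simpa using isUnshuffle_two_iff s
  rw [h, Finset.sum_insert (by decide), Finset.sum_insert (by decide), Finset.sum_singleton]

open Classical in
-- In the equation with three arguments the source contributes only `f_2([·, ·], ·)`, and among the
-- target brackets only `l_3` has a function component. What remains is `δ f_2 = ± g_3`. The exact
-- sign does not matter for non-exactness.
theorem ceD_secondComponent {σ : Forms E M 3} {hσ : extD E M 3 σ = 0}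
    (F : LInftyMorphism (lieBracketData L) (observables hσ)) {ζ : L →ₗ[ℝ] VF E M}
    (hF : ∀ X, (F.f 1 ![X]).1.1.1 = ζ X) :
    ∃ ε : ℤˣ, ceD L _ 2 (secondComponent F) = ε • cocycle3 σ ζ := by
  -- The minus sign appears because the unshuffle sum over `f_2([·, ·], ·)` is `-δ f_2`.
  refine ⟨-(signExponent (Composition.ones 3) 1 fun _ => 0).negOnePow, ?_⟩
  ext x : 1
  have h := F.relation 3 (by norm_num) (fun _ => 0) x (fun i => by simp [lieBracketData])
  have hc {m : ℕ} (y : Fin m → L) : F.f (m + 1) (Fin.cons 0 y) = 0 :=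
    (F.f (m + 1)).map_coord_zero (0 : Fin (m + 1)) rfl
  rw [Fin.sum_univ_three] at h
  -- The source has no unary or ternary bracket, so only the three `(2, 1)`-unshuffles survive. The
  -- index stays in the form `1 + 1`, as `sum_isUnshuffle` expects it.
  simp [koszulSign_zero, lieBracketData, hc, sum_isUnshuffle, -Nat.reduceAdd] at h
  have h := congrArg Prod.snd h
  have hsnd {k : ℕ} (hk : k ≠ 3) (ε : ℤˣ) (y : Fin k → Observables σ) :
      (ε • (observables hσ).br k y).2 = 0 := by
    rw [Prod.smul_snd, observables_br_snd hσ hk, smul_zero]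
  -- Compositions with fewer than three blocks feed `l_1` or `l_2`, which have zero function
  -- component.
  rw [Prod.snd_sum, Finset.sum_eq_single (Composition.ones 3)] at h
  · have hu : (Finset.univ.filter fun s : Equiv.Perm (Fin 3) =>
        IsBlockUnshuffle (Composition.ones 3) s) = {1} := by
      ext s; simp [isBlockUnshuffle_ones_iff]
    rw [hu, Finset.sum_singleton, Equiv.Perm.sign_one, mul_one, Prod.smul_snd] at h
    have h3 : cocycle3 σ ζ x = -(contr (F.f 1 ![x 2]).1.1.1 (contr (F.f 1 ![x 1]).1.1.1
        (contr (F.f 1 ![x 0]).1.1.1 σ))) := by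
      rw [hF, hF, hF]; rfl
    have h2 : (((observables hσ).br (Composition.ones 3).length) fun j =>
        (F.f ((Composition.ones 3).blocksFun j)) fun a =>
          x ((1 : Equiv.Perm (Fin 3)) (((Composition.ones 3).embedding j) a))).2 =
        cocycle3 σ ζ x := by
      -- The block sizes equal one only propositionally, so the components indexed by them have to
      -- be transported to `f 1`.
      have hf (j : Fin (Composition.ones 3).length) (i : Fin 3) (hij : (⟨j, by simpa using j.2⟩ : Fin 3) = i) :
          (F.f ((Composition.ones 3).blocksFun j) fun a =>
            x ((1 : Equiv.Perm (Fin 3)) (((Composition.ones 3).embedding j) a))) = F.f 1 ![x i] := by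
        have h1 {m : ℕ} (hm : m = 1) (y : Fin m → L) : F.f m y = F.f 1 ![y ⟨0, by omega⟩] := by
          subst hm
          congr 1
          funext i
          fin_cases i; rfl
        rw [h1 (Composition.ones_blocksFun 3 j), ← hij]
        exact congrArg (fun i => F.f 1 ![x i]) (Composition.ones_embedding j _)
      rw [h3, ← hf (0 : Fin 3) 0 rfl, ← hf (1 : Fin 3) 1 rfl, ← hf (2 : Fin 3) 2 rfl]
      exact observables_br_three hσ _
    have h4 : (F.f 2 ![⁅x 0, x 1⁆, x 2] + (-F.f 2 ![⁅x 0, x 2⁆, x 1] + F.f 2 ![⁅x 1, x 2⁆, x 0])).2 =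
        (signExponent (Composition.ones 3) 1 fun _ => 0).negOnePow • cocycle3 σ ζ x := by
      rw [← h2]
      refine Eq.trans ?_ h
      refine congrArg Prod.snd (congrArg₂ (· + ·) (congrArg (F.f 2) ?_) (congrArg₂ (· + ·)
        (congrArg Neg.neg (congrArg (F.f 2) ?_)) (congrArg (F.f 2) ?_))) <;>
      · funext i; fin_cases i <;> rfl
    have hs (y : Fin 2 → L) : secondComponent F y = (F.f 2 y).2 := rfl
    rw [ceD_two_apply, hs, hs, hs, Units.neg_smul, AlternatingMap.neg_apply]
    refine Eq.trans ?_ (congrArg Neg.neg h4)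
    simp only [Prod.snd_add, Prod.snd_neg]
    abel
  · intro c _ hc3
    rw [Prod.snd_sum]
    exact Finset.sum_eq_zero fun s _ => hsnd (fun h => hc3 (Composition.eq_ones_iff_length.2 h)) _ _
  · intro h
    refine absurd (Finset.mem_filter.2 ⟨Finset.mem_univ _, fun i j _ => ?_⟩) h
    simp

end Morphism

/-! ### The total complex in low bidegrees and evaluation at a point. -/

section Total

variable {E : Type*} [NormedAddCommGroup E] [NormedSpace ℝ E] [CompleteSpace E]
  {M : Type*} [TopologicalSpace M] [ChartedSpace E M] [IsManifold 𝓘(ℝ, E) ∞ M]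
  {L : Type*} [LieRing L] [LieAlgebra ℝ L]

theorem totalD_zero_succ (p : BiCochain E M L) (j : ℕ) : totalD E M L p 0 (j + 1) =
    ((-1 : ℝ) ^ 2 * (-1) ^ (0 + j)) • (extD E M j).compAlternatingMap (p 0 j) :=
  zero_add _

theorem totalD_succ_zero (p : BiCochain E M L) (i : ℕ) :
    totalD E M L p (i + 1) 0 = ceD L (Forms E M 0) i (p i 0) :=
  add_zero _

theorem totalD_succ_succ (p : BiCochain E M L) (i j : ℕ) : totalD E M L p (i + 1) (j + 1) =
    ceD L (Forms E M (j + 1)) i (p i (j + 1)) +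
      ((-1 : ℝ) ^ 2 * (-1) ^ (i + 1 + j)) • (extD E M j).compAlternatingMap (p (i + 1) j) := rfl

/-- Lets every check of a total differential stop at the finitely many bidegrees of the relevant
total degree. -/
theorem totalD_mem {k : ℕ} {p : BiCochain E M L} (hp : p ∈ totalDegree E M L k) :
    totalD E M L p ∈ totalDegree E M L (k + 1) := by
  intro i j h
  rcases i with _ | i <;> rcases j with _ | j
  · exact add_zero _
  · rw [totalD_zero_succ, hp 0 j (by omega)]; simp
  · rw [totalD_succ_zero, hp i 0 (by omega)]; simp
  · rw [totalD_succ_succ, hp i (j + 1) (by omega), hp (i + 1) j (by omega)]; simp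

theorem totalCocycle_mem (σ : Forms E M 3) (ζ : L →ₗ[ℝ] VF E M) :
    totalCocycle σ ζ ∈ totalDegree E M L 3 := by
  intro i j h
  unfold totalCocycle
  split <;> first | rfl | omega

theorem totalTensorOne_mem (a : L [⋀^Fin 3]→ₗ[ℝ] ℝ) :
    totalTensorOne E M L a ∈ totalDegree E M L 3 := by
  intro i j h
  unfold totalTensorOne
  split <;> first | rfl | omega

theorem totalTensorOne_cocycle {a : L [⋀^Fin 3]→ₗ[ℝ] ℝ} (ha : ceD L ℝ 3 a = 0) :
    totalTensorOne E M L a ∈ totalCocycles E M L 3 := by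
  refine ⟨totalTensorOne_mem a, funext fun i => funext fun j => ?_⟩
  by_cases h : i + j = 3 + 1
  · obtain ⟨rfl, rfl⟩ | ⟨rfl, rfl⟩ | ⟨rfl, rfl⟩ | ⟨rfl, rfl⟩ | ⟨rfl, rfl⟩ :
        i = 0 ∧ j = 4 ∨ i = 1 ∧ j = 3 ∨ i = 2 ∧ j = 2 ∨ i = 3 ∧ j = 1 ∨ i = 4 ∧ j = 0 := by omega
    · rw [totalD_zero_succ]; simp [totalTensorOne]
    · rw [totalD_succ_succ]; simp [totalTensorOne]
    · rw [totalD_succ_succ]; simp [totalTensorOne]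
    · rw [totalD_succ_succ]
      ext X : 1
      simp [totalTensorOne, tensorOne, extD_constForm]
    · rw [totalD_succ_zero]
      exact (ceD_comp L 3 (constForm E M) a).trans (by rw [ha]; ext; simp)
  · exact totalD_mem (totalTensorOne_mem a) i j h

/-- The cochain of bidegree `(1, 1)` given by a linear map with values in one-forms. -/
def totalOneForm (η : L →ₗ[ℝ] Forms E M 1) : BiCochain E M L
  | 1, 1 => AlternatingMap.ofSubsingleton ℝ L (Forms E M 1) (0 : Fin 1) η
  | _, _ => 0

theorem totalOneForm_mem (η : L →ₗ[ℝ] Forms E M 1) :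
    totalOneForm η ∈ totalDegree E M L 2 := by
  intro i j h
  unfold totalOneForm
  split <;> first | rfl | omega

/-- Evaluation of functions at a point. -/
def evalAt (x : M) : Forms E M 0 →ₗ[ℝ] ℝ where
  toFun α := α.1 x ![]
  map_add' _ _ := rfl
  map_smul' _ _ := rfl

theorem evalAt_tensorOne (x : M) {k : ℕ} (a : L [⋀^Fin k]→ₗ[ℝ] ℝ) :
    (evalAt (E := E) x).compAlternatingMap (tensorOne E M L k a) = a := rfl

/-- Evaluation at a point is a map of coefficients, so it commutes with `δ`, and it undoes `a ↦ a ⊗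
1`. A primitive with function coefficients therefore yields a real one. -/
theorem exact_of_tensorOne_exact (x : M) {k : ℕ} {a : L [⋀^Fin (k + 1)]→ₗ[ℝ] ℝ}
    {b : L [⋀^Fin k]→ₗ[ℝ] Forms E M 0} (h : ceD L _ k b = tensorOne E M L (k + 1) a) :
    ceD L ℝ k ((evalAt x).compAlternatingMap b) = a := by
  rw [ceD_comp, h, evalAt_tensorOne]

end Total

/-! ### One-forms dual to the action through the Killing form. -/

section Simple

open scoped TensorProduct

variable {L : Type*} [LieRing L] [LieAlgebra ℝ L]

theorem lift_lie_surjective (h : LieAlgebra.IsSimple ℝ L) :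
    Function.Surjective (TensorProduct.lift (LieModule.toEnd ℝ L L : L →ₗ[ℝ] L →ₗ[ℝ] L)) := by
  rw [← LinearMap.range_eq_top, eq_top_iff, ← span_lie_eq_top h, Submodule.span_le]
  rintro _ ⟨X, Y, rfl⟩
  exact ⟨X ⊗ₜ Y, by simp⟩

variable {E : Type*} [NormedAddCommGroup E] [NormedSpace ℝ E] [CompleteSpace E]
  {M : Type*} [TopologicalSpace M] [ChartedSpace E M] [IsManifold 𝓘(ℝ, E) ∞ M]

/-- An infinitesimal action of a simple Lie algebra on a manifold with a `3`-form which takes the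
constant values `- ⟨X, [Y, Z]⟩` on it admits one-forms which take the values `⟨X, W⟩`. -/
theorem exists_killing_oneForm (h : LieAlgebra.IsSimple ℝ L) {σ : Forms E M 3} {ζ : L →ₗ[ℝ] VF E M}
    (hσ : ∀ (X : Fin 3 → L) x, σ.1 x (fun i => ζ (X i) x) = - cartan3 L X) :
    ∃ η : L →ₗ[ℝ] Forms E M 1, ∀ (X : L) (W : Fin 1 → L) (x : M),
      (η X).1 x (fun i => ζ (W i) x) = killingForm ℝ L X (W 0) := by
  -- A linear section `s` of the bracket `L ⊗ L → L` writes each `X` as a sum of brackets. The form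
  -- `η(X)` is then a sum of contractions of `σ`, so it is smooth and linear in `X` by construction.
  obtain ⟨s, hs⟩ := LinearMap.exists_rightInverse_of_surjective _
    (LinearMap.range_eq_top.2 (lift_lie_surjective h))
  let B : L →ₗ[ℝ] L →ₗ[ℝ] Forms E M 1 := -LinearMap.mk₂ ℝ
    (fun X Y => contr (ζ Y) (contr (ζ X) σ)) (by simp) (by simp) (by simp) (by simp)
  refine ⟨TensorProduct.lift B ∘ₗ s, fun X W x => ?_⟩
  -- On pure tensors: `⟨[X, Y], W⟩ = ⟨X, [Y, W]⟩ = -σ(ζX, ζY, ζW)`, which explains the sign in `B`.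
  -- The values depend only on the bracket, so the choice of `s` is immaterial.
  have key (t : L ⊗[ℝ] L) : (TensorProduct.lift B t).1 x (fun i => ζ (W i) x) =
      killingForm ℝ L (TensorProduct.lift (LieModule.toEnd ℝ L L : L →ₗ[ℝ] L →ₗ[ℝ] L) t) (W 0) := by
    induction t with
    | zero => simp; rfl
    | add a b ha hb =>
      rw [map_add, map_add, map_add, LinearMap.add_apply, ← ha, ← hb]; rfl
    | tmul X Y =>
      have h1 := hσ ![X, Y, W 0] x
      have h2 : (fun i => ζ ((![X, Y, W 0] : Fin 3 → L) i) x) =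
          Matrix.vecCons (ζ X x) (Matrix.vecCons (ζ Y x) fun i => ζ (W i) x) := by
        funext i; fin_cases i <;> rfl
      rw [h2, cartan3_apply, ← killing_lie] at h1
      rw [TensorProduct.lift.tmul, TensorProduct.lift.tmul]
      exact neg_eq_iff_eq_neg.2 h1
  exact (key (s X)).trans (congrArg (fun Z => killingForm ℝ L Z (W 0)) (LinearMap.congr_fun hs X))

end Simple

/-! ### Consequences for a transitive action with constant Cartan values. -/

section Transitive

variable {E : Type*} [NormedAddCommGroup E] [NormedSpace ℝ E] [CompleteSpace E]
  {M : Type*} [TopologicalSpace M] [ChartedSpace E M] [IsManifold 𝓘(ℝ, E) ∞ M]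
  {L : Type*} [LieRing L] [LieAlgebra ℝ L] {σ : Forms E M 3} {ζ : L →ₗ[ℝ] VF E M}
  {η : L →ₗ[ℝ] Forms E M 1}

theorem extD_eq_zero_of_cartan3 (hζ : ∀ X Y, ζ ⁅X, Y⁆ = lieBr (ζ X) (ζ Y))
    (hs : ∀ x (u : TangentSpace 𝓘(ℝ, E) x), ∃ X, ζ X x = u)
    (hσ : ∀ (X : Fin 3 → L) x, σ.1 x (fun i => ζ (X i) x) = - cartan3 L X) :
    extD E M 3 σ = 0 := by
  refine forms_ext_of_transitive hs fun X x => ?_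
  rw [extD_apply_of_const hζ σ (- cartan3 L) hσ, map_neg, ceD_cartan3, neg_zero]
  rfl

theorem contr_apply_action (hσ : ∀ (X : Fin 3 → L) x, σ.1 x (fun i => ζ (X i) x) = - cartan3 L X)
    (X : L) (W : Fin 2 → L) (x : M) :
    (contr (ζ X) σ).1 x (fun i => ζ (W i) x) = - killingForm ℝ L X ⁅W 0, W 1⁆ := by
  have h1 := hσ ![X, W 0, W 1] x
  have h2 : (fun i => ζ ((![X, W 0, W 1] : Fin 3 → L) i) x) =
      Matrix.vecCons (ζ X x) (fun i => ζ (W i) x) := by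
    funext i; fin_cases i <;> rfl
  rw [h2] at h1
  exact h1

/-- On action fields both sides equal `-⟨X, [W 0, W 1]⟩`: the left one is `δ` of the functional `⟨X,
·⟩`, the right one a value of `σ`. -/
theorem extD_killing_oneForm (hζ : ∀ X Y, ζ ⁅X, Y⁆ = lieBr (ζ X) (ζ Y))
    (hs : ∀ x (u : TangentSpace 𝓘(ℝ, E) x), ∃ X, ζ X x = u)
    (hσ : ∀ (X : Fin 3 → L) x, σ.1 x (fun i => ζ (X i) x) = - cartan3 L X)
    (hη : ∀ (X : L) (W : Fin 1 → L) (x : M),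
      (η X).1 x (fun i => ζ (W i) x) = killingForm ℝ L X (W 0)) (X : L) :
    extD E M 1 (η X) = contr (ζ X) σ := by
  refine forms_ext_of_transitive hs fun W x => ?_
  rw [extD_apply_of_const hζ (η X)
    (AlternatingMap.ofSubsingleton ℝ L ℝ (0 : Fin 1) (killingForm ℝ L X)) (hη X), ceD_one_apply,
    contr_apply_action hσ]
  rfl

theorem killing_oneForm_lie (hs : ∀ x (u : TangentSpace 𝓘(ℝ, E) x), ∃ X, ζ X x = u)
    (hσ : ∀ (X : Fin 3 → L) x, σ.1 x (fun i => ζ (X i) x) = - cartan3 L X)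
    (hη : ∀ (X : L) (W : Fin 1 → L) (x : M),
      (η X).1 x (fun i => ζ (W i) x) = killingForm ℝ L X (W 0)) (X Y : L) :
    η ⁅X, Y⁆ = - contr (ζ Y) (contr (ζ X) σ) := by
  refine forms_ext_of_transitive hs fun W x => ?_
  rw [hη]
  have h1 := contr_apply_action hσ X ![Y, W 0] x
  have h2 : (fun i => ζ ((![Y, W 0] : Fin 2 → L) i) x) =
      Matrix.vecCons (ζ Y x) (fun i => ζ (W i) x) := by
    funext i; fin_cases i <;> rfl
  rw [h2] at h1
  rw [killing_lie]
  exact (neg_eq_iff_eq_neg.2 h1).symm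

/-- The lift is `X ↦ (ζ X, -η X)`; the sign comes from the convention `dα = -ι_v σ`. -/
theorem weaklyHamiltonian_of_primitive (h : ∀ X, extD E M 1 (η X) = contr (ζ X) σ) :
    WeaklyHamiltonian σ ζ :=
  ⟨LinearMap.codRestrict (HamPairs σ) (LinearMap.prod ζ (-η)) fun X => by
    show extD E M 1 (-(η X)) = - contr (ζ X) σ
    rw [map_neg, h], fun _ => rfl⟩

theorem compAlternating_oneForm (h : ∀ X, extD E M 1 (η X) = contr (ζ X) σ) :
    (extD E M 1).compAlternatingMap (AlternatingMap.ofSubsingleton ℝ L _ (0 : Fin 1) η) =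
      cocycle1 σ ζ :=
  AlternatingMap.ext fun X => h (X 0)

theorem ceD_oneForm (h : ∀ X Y, η ⁅X, Y⁆ = - contr (ζ Y) (contr (ζ X) σ)) :
    ceD L _ 1 (AlternatingMap.ofSubsingleton ℝ L _ (0 : Fin 1) η) = cocycle2 σ ζ := by
  ext X : 1
  rw [ceD_one_apply]
  exact neg_eq_iff_eq_neg.2 (h (X 0) (X 1))

theorem cocycle3_eq_tensorOne
    (hσ : ∀ (X : Fin 3 → L) x, σ.1 x (fun i => ζ (X i) x) = - cartan3 L X) :
    cocycle3 σ ζ = tensorOne E M L 3 (cartan3 L) := by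
  ext X : 1
  refine Subtype.ext (funext fun x => ?_)
  ext u
  have h2 : (Matrix.vecCons (ζ (X 0) x) (Matrix.vecCons (ζ (X 1) x)
      (Matrix.vecCons (ζ (X 2) x) u))) = fun i => ζ (X i) x := by
    funext i; fin_cases i <;> rfl
  exact (congrArg (fun w => - σ.1 x w) h2).trans (by rw [hσ, neg_neg]; rfl)

theorem obstruction1_eq_zero (h : ∀ X, extD E M 1 (η X) = contr (ζ X) σ) : obstruction1 σ ζ = 0 :=
  (Submodule.Quotient.mk_eq_zero _).2 (Submodule.mem_sup_right fun X => ⟨η (X 0), h (X 0)⟩)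

theorem obstruction2_eq_zero (h : ∀ X Y, η ⁅X, Y⁆ = - contr (ζ Y) (contr (ζ X) σ)) :
    obstruction2 σ ζ = 0 :=
  (Submodule.Quotient.mk_eq_zero _).2 (Submodule.mem_sup_left ⟨_, ceD_oneForm h⟩)

theorem obstruction3_ne_zero [Module.Finite ℝ L] [Nonempty M] (hL : LieAlgebra.IsSimple ℝ L)
    (hσ : ∀ (X : Fin 3 → L) x, σ.1 x (fun i => ζ (X i) x) = - cartan3 L X) :
    obstruction3 σ ζ ≠ 0 := by
  intro h
  obtain ⟨a, ⟨b, rfl⟩, c, hc, hbc⟩ := Submodule.mem_sup.1 ((Submodule.Quotient.mk_eq_zero _).1 h)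
  -- The space of exact 0-forms is zero, so in bidegree `(3, 0)` only the Chevalley-Eilenberg
  -- coboundaries are divided out.
  have hc0 : c = 0 := AlternatingMap.ext fun X => (Submodule.mem_bot ℝ).1 (hc X)
  rw [hc0, add_zero, cocycle3_eq_tensorOne hσ] at hbc
  exact cartan3_ne_ceD hL _ (exact_of_tensorOne_exact (Classical.arbitrary M) hbc)

theorem not_stronglyHamiltonian [Module.Finite ℝ L] [Nonempty M] (hL : LieAlgebra.IsSimple ℝ L)
    (hσ : ∀ (X : Fin 3 → L) x, σ.1 x (fun i => ζ (X i) x) = - cartan3 L X)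
    (hclosed : extD E M 3 σ = 0) : ¬ StronglyHamiltonian hclosed ζ := by
  rintro ⟨F, hF⟩
  obtain ⟨ε, hε⟩ := ceD_secondComponent F hF
  rw [cocycle3_eq_tensorOne hσ] at hε
  -- The undetermined sign is moved into the primitive.
  have h : ceD L _ 2 (ε • secondComponent F) = tensorOne E M L 3 (cartan3 L) := by
    rcases Int.units_eq_one_or ε with rfl | rfl
    · simpa using hε
    · rw [Units.neg_smul, one_smul] at hε ⊢
      rw [map_neg, hε, neg_neg]
  exact cartan3_ne_ceD hL _ (exact_of_tensorOne_exact (Classical.arbitrary M) h)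

/-- The family `η`, placed in bidegree `(1, 1)`, has `dη = g_1` and `δη = g_2`. The `(3, 0)` part of
the right-hand side cancels because `g_3 = ω_e ⊗ 1`. -/
theorem totalD_oneForm (hσ : ∀ (X : Fin 3 → L) x, σ.1 x (fun i => ζ (X i) x) = - cartan3 L X)
    (h1 : ∀ X, extD E M 1 (η X) = contr (ζ X) σ)
    (h2 : ∀ X Y, η ⁅X, Y⁆ = - contr (ζ Y) (contr (ζ X) σ)) :
    totalD E M L (totalOneForm η) = totalCocycle σ ζ - totalTensorOne E M L (cartan3 L) := by
  funext i j
  by_cases h : i + j = 2 + 1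
  · obtain ⟨rfl, rfl⟩ | ⟨rfl, rfl⟩ | ⟨rfl, rfl⟩ | ⟨rfl, rfl⟩ :
        i = 0 ∧ j = 3 ∨ i = 1 ∧ j = 2 ∨ i = 2 ∧ j = 1 ∨ i = 3 ∧ j = 0 := by omega
    · rw [totalD_zero_succ]; simp [totalOneForm, totalCocycle, totalTensorOne]
    · rw [totalD_succ_succ]
      simp only [totalOneForm, totalCocycle, totalTensorOne, Pi.sub_apply, map_zero]
      -- On bidegree `(1, 1)` the sign in front of `d` is `(-1)^2 (-1)^2 = 1`.
      rw [compAlternating_oneForm h1]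
      norm_num
    · rw [totalD_succ_succ]
      simp only [totalOneForm, totalCocycle, totalTensorOne, Pi.sub_apply]
      rw [ceD_oneForm h2]
      simp
    · rw [totalD_succ_zero]
      simp [totalOneForm, totalCocycle, totalTensorOne, cocycle3_eq_tensorOne hσ]
  · rw [totalD_mem (totalOneForm_mem η) i j h,
      sub_mem (totalCocycle_mem σ ζ) (totalTensorOne_mem (cartan3 L)) i j h]

/-- The instance of `δ² = 0` needed for `δ g_2 = δ δ η = 0`; it is the Jacobi identity under `η`. -/
theorem ceD_ceD_oneForm (η : L →ₗ[ℝ] Forms E M 1) :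
    ceD L _ 2 (ceD L _ 1 (AlternatingMap.ofSubsingleton ℝ L _ (0 : Fin 1) η)) = 0 := by
  ext X : 1
  have h (Y : L) : AlternatingMap.ofSubsingleton ℝ L _ (0 : Fin 1) η ![Y] = η Y := rfl
  have hj := congrArg η (lie_lie (X 0) (X 1) (X 2))
  rw [map_sub, ← lie_skew (X 0) ⁅X 1, X 2⁆, ← lie_skew (X 1) ⁅X 0, X 2⁆, map_neg, map_neg] at hj
  rw [ceD_two_apply]
  simp only [ceD_one_apply, h, Matrix.cons_val_zero, Matrix.cons_val_one, AlternatingMap.zero_apply]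
  rw [hj]
  abel

/-- Cartan's identity `d ι_w ι_v σ = -ι_[v,w] σ`, read on the action fields. -/
theorem ceD_cocycle1 (hζ : ∀ X Y, ζ ⁅X, Y⁆ = lieBr (ζ X) (ζ Y)) (hclosed : extD E M 3 σ = 0)
    (h1 : ∀ X, extD E M 2 (contr (ζ X) σ) = 0) :
    ceD L _ 1 (cocycle1 σ ζ) = (extD E M 1).compAlternatingMap (cocycle2 σ ζ) := by
  ext X : 1
  rw [ceD_one_apply]
  refine Eq.trans ?_ (extD_contr_contr hclosed (h1 (X 0)) (h1 (X 1))).symm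
  rw [← hζ]
  rfl

theorem totalCocycle_cocycle (hζ : ∀ X Y, ζ ⁅X, Y⁆ = lieBr (ζ X) (ζ Y))
    (hclosed : extD E M 3 σ = 0)
    (hσ : ∀ (X : Fin 3 → L) x, σ.1 x (fun i => ζ (X i) x) = - cartan3 L X)
    (h1 : ∀ X, extD E M 1 (η X) = contr (ζ X) σ)
    (h2 : ∀ X Y, η ⁅X, Y⁆ = - contr (ζ Y) (contr (ζ X) σ)) :
    totalCocycle σ ζ ∈ totalCocycles E M L 3 := by
  have h3 (X : L) : extD E M 2 (contr (ζ X) σ) = 0 := by rw [← h1, extD_extD]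
  refine ⟨totalCocycle_mem σ ζ, funext fun i => funext fun j => ?_⟩
  by_cases h : i + j = 3 + 1
  · obtain ⟨rfl, rfl⟩ | ⟨rfl, rfl⟩ | ⟨rfl, rfl⟩ | ⟨rfl, rfl⟩ | ⟨rfl, rfl⟩ :
        i = 0 ∧ j = 4 ∨ i = 1 ∧ j = 3 ∨ i = 2 ∧ j = 2 ∨ i = 3 ∧ j = 1 ∨ i = 4 ∧ j = 0 := by omega
    · rw [totalD_zero_succ]; simp [totalCocycle]
    · rw [totalD_succ_succ]
      ext X : 1
      simp [totalCocycle, cocycle1, h3]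
    · rw [totalD_succ_succ]
      simp only [totalCocycle]
      -- On bidegree `(2, 1)` the sign in front of `d` is `-1`, so `δ g_1` cancels `d g_2`.
      rw [ceD_cocycle1 hζ hclosed h3]
      norm_num
    · rw [totalD_succ_succ]
      simp only [totalCocycle]
      -- Both contributions vanish separately: `g_2 = δη` is `δ`-closed and `g_3` consists of
      -- constant functions.
      rw [← ceD_oneForm h2, ceD_ceD_oneForm, cocycle3_eq_tensorOne hσ]
      ext X : 1
      simp [tensorOne, extD_constForm]
    · rw [totalD_succ_zero]
      simp only [totalCocycle]
      rw [cocycle3_eq_tensorOne hσ]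
      exact (ceD_comp L 3 (constForm E M) (cartan3 L)).trans (by rw [ceD_cartan3]; ext; simp)
  · exact totalD_mem (totalCocycle_mem σ ζ) i j h

theorem totalClass_eq (hσ : ∀ (X : Fin 3 → L) x, σ.1 x (fun i => ζ (X i) x) = - cartan3 L X)
    (h1 : ∀ X, extD E M 1 (η X) = contr (ζ X) σ)
    (h2 : ∀ X Y, η ⁅X, Y⁆ = - contr (ζ Y) (contr (ζ X) σ))
    (hcoc : totalCocycle σ ζ ∈ totalCocycles E M L 3)
    (hten : totalTensorOne E M L (cartan3 L) ∈ totalCocycles E M L 3) :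
    totalClass 3 _ hcoc = totalClass 3 _ hten :=
  (Submodule.Quotient.eq _).2 ⟨totalOneForm η, totalOneForm_mem η, totalD_oneForm hσ h1 h2⟩

theorem totalClass_ne_zero [Module.Finite ℝ L] [Nonempty M] (hL : LieAlgebra.IsSimple ℝ L)
    (hσ : ∀ (X : Fin 3 → L) x, σ.1 x (fun i => ζ (X i) x) = - cartan3 L X)
    (hcoc : totalCocycle σ ζ ∈ totalCocycles E M L 3) : totalClass 3 _ hcoc ≠ 0 := by
  intro h
  obtain ⟨p, _, hp⟩ := (Submodule.Quotient.mk_eq_zero _).1 h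
  -- Nothing enters bidegree `(3, 0)` through `d`, so this component of a total coboundary is `δ` of
  -- the `(2, 0)` component of `p`.
  have h30 := congrFun (congrFun hp 3) 0
  rw [totalD_succ_zero] at h30
  exact cartan3_ne_ceD hL _ (exact_of_tensorOne_exact (Classical.arbitrary M)
    (h30.trans (cocycle3_eq_tensorOne hσ)))

end Transitive

end Multisymplectic

end

open Multisymplectic

/-! ### The Cartan 3-form of a simple Lie group. -/

theorem mainTheorem8 {E : Type*} [NormedAddCommGroup E] [NormedSpace ℝ E] [CompleteSpace E]
    [FiniteDimensional ℝ E] {G : Type*} [TopologicalSpace G] [ChartedSpace E G] [Group G]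
    [LieGroup 𝓘(ℝ, E) ∞ G] [ConnectedSpace G]
    (hG : LieAlgebra.IsSimple ℝ (GroupLieAlgebra 𝓘(ℝ, E) G)) :
    ∃ hclosed : extD E G 3 (cartanForm E G) = 0,
      Nondegenerate (cartanForm E G) ∧
      (∀ a : G, PullbackInvariant (fun g => a * g) (cartanForm E G)) ∧
      (∀ a : G, PullbackInvariant (fun g => g * a) (cartanForm E G)) ∧
      (∀ X Y : GroupLieAlgebra 𝓘(ℝ, E) G,
        leftAction ⁅X, Y⁆ = lieBr (leftAction X) (leftAction Y)) ∧
      (∀ X : GroupLieAlgebra 𝓘(ℝ, E) G, lieDer (leftAction X) (cartanForm E G) = 0) ∧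
      WeaklyHamiltonian (cartanForm E G) (leftAction (E := E) (G := G)) ∧
      ¬ StronglyHamiltonian hclosed (leftAction (E := E) (G := G)) ∧
      obstruction1 (cartanForm E G) (leftAction (E := E) (G := G)) = 0 ∧
      obstruction2 (cartanForm E G) (leftAction (E := E) (G := G)) = 0 ∧
      ∃ (hcart : cartan3 (GroupLieAlgebra 𝓘(ℝ, E) G) ∈
            LinearMap.ker (ceD (GroupLieAlgebra 𝓘(ℝ, E) G) ℝ 3))
        (hcoc : totalCocycle (cartanForm E G) (leftAction (E := E) (G := G)) ∈
            totalCocycles E G (GroupLieAlgebra 𝓘(ℝ, E) G) 3)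
        (hten : totalTensorOne E G (GroupLieAlgebra 𝓘(ℝ, E) G)
            (cartan3 (GroupLieAlgebra 𝓘(ℝ, E) G)) ∈
            totalCocycles E G (GroupLieAlgebra 𝓘(ℝ, E) G) 3),
        (cohClass _ (ceExact _ ℝ 3) (cartan3 (GroupLieAlgebra 𝓘(ℝ, E) G)) hcart :
            ceH (GroupLieAlgebra 𝓘(ℝ, E) G) ℝ 3) ≠ 0 ∧
        obstruction3 (cartanForm E G) (leftAction (E := E) (G := G)) =
          ceHToMixed E G (GroupLieAlgebra 𝓘(ℝ, E) G) 3
            (cohClass _ (ceExact _ ℝ 3) (cartan3 (GroupLieAlgebra 𝓘(ℝ, E) G)) hcart) ∧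
        obstruction3 (cartanForm E G) (leftAction (E := E) (G := G)) ≠ 0 ∧
        totalClass 3 _ hcoc = totalClass 3 _ hten ∧
        totalClass 3 _ hcoc ≠ 0 := by
  have hs (g : G) (u : TangentSpace 𝓘(ℝ, E) g) :
      ∃ X : GroupLieAlgebra 𝓘(ℝ, E) G, leftAction X g = u := by
    -- The vector `-u` compensates the sign in `leftAction X g = -rightInvariant X g`.
    obtain ⟨X, hX⟩ := rightInvariant_surjective (E := E) g (-u : E)
    refine ⟨X, (leftAction_apply X g).trans ?_⟩
    rw [hX]
    exact neg_neg (u : E)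
  have hσ := cartanForm_leftAction (E := E) (G := G)
  have hclosed := extD_eq_zero_of_cartan3 leftAction_lie hs hσ
  obtain ⟨η, hη⟩ := exists_killing_oneForm hG hσ
  have h1 := extD_killing_oneForm leftAction_lie hs hσ hη
  have h2 := killing_oneForm_lie hs hσ hη
  refine ⟨hclosed, cartanForm_nondegenerate hG, cartanForm_pullback_left,
    cartanForm_pullback_right, leftAction_lie, fun X => ?_, weaklyHamiltonian_of_primitive h1,
    not_stronglyHamiltonian hG hσ hclosed, obstruction1_eq_zero h1, obstruction2_eq_zero h2,
    ceD_cartan3, totalCocycle_cocycle leftAction_lie hclosed hσ h1 h2,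
    totalTensorOne_cocycle ceD_cartan3, fun h => ?_, ?_, obstruction3_ne_zero hG hσ,
    totalClass_eq hσ h1 h2 _ _, totalClass_ne_zero hG hσ _⟩
  -- In Cartan's formula the term with `dω` vanishes, and the other one is `d d η(X)`.
  · rw [lieDer, hclosed, map_zero, add_zero, ← h1, extD_extD]
  · obtain ⟨b, hb⟩ := (Submodule.Quotient.mk_eq_zero _).1 h
    exact cartan3_ne_ceD hG b hb
  · exact congrArg Submodule.Quotient.mk (cocycle3_eq_tensorOne hσ)
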